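/- Let $G$ be a finite connected undirected planar graph (parallel edges and loops are allowed) with a fixed embedding in the sphere, and let every edge $e$ have a capacity $c(e)>0$ (the unweighted case is $c\equiv 1$). Let $G^*$ be the embedded dual multigraph: its vertices are the faces of $G$, its faces correspond to the vertices of $G$, and the dual $e^*$ of an edge $e$ has length $c(e)$. Let $s\neq t$ be vertices of $G$, let $f_s^*$ and $f_t^*$ be vertices of $G^*$ that correspond to a face of $G$ adjacent to $s$ and a face of $G$ adjacent to $t$, and let $\pi$ be a shortest path in $G^*$ from $f_s^*$ to $f_t^*$ (possibly trivial). Extend $\pi$ by two dummy edges: one joining $s$ to $f_s^*$ through a corner of the face $f_s$ at $s$, and one joining $f_t^*$ to $t$ through a corner of the face $f_t$ at $t$. At each vertex of $\pi$, every edge end that does not belong to the extended path then lies either to the left or to the right of $\pi$. An $st$-separating cycle is a simple cycle $C$ of $G^*$ (of any length $\ge 1$) such that $s$ and $t$, viewed as faces of $G^*$, lie on different sides of $C$; equivalently, every walk from $s$ to $t$ in $G$ uses an edge $e$ with $e^*\in C$. It is shortest if its total length is minimum among all $st$-separating cycles. A crossing between $C$ and $\pi$ is a subpath $v_1,v_2,\dots,v_k$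 of $C$, $k\ge 3$ (whose first and last edge may coincide if $C$ has only one edge outside $v_2,\dots,v_{k-1}$), such that $v_2,\dots,v_{k-1}$ is a common subpath of $C$ and $\pi$ and the edges $v_1v_2$ (at $v_2$) and $v_{k-1}v_k$ (at $v_{k-1}$) lie on different sides of $\pi$. The cycle $C$ is single-crossing if there is exactly one crossing between $C$ and $\pi$. Then every edge of $G^*$ that is contained in a shortest $st$-separating cycle is also contained in a single-crossing shortest $st$-separating cycle. -/

import Mathlib

/-- A finite undirected multigraph (loops and parallel edges allowed) with vertex set `V`, together
with a cellular embedding in an oriented closed surface, given by its rotation system.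
`D` is the set of darts (oriented edges). Each dart leaves the vertex `tail d`; the same edge with
the opposite orientation is `rev d`; and `rot d` is the next dart, counterclockwise, among the
darts that leave the same vertex. -/
structure EmbeddedGraph (V D : Type*) where
  tail : D → V
  rev : Equiv.Perm D
  rot : Equiv.Perm D
  rev_rev : ∀ d, rev (rev d) = d
  rev_ne : ∀ d, rev d ≠ d
  tail_eq_iff : ∀ d e, tail d = tail e ↔ rot.SameCycle d e

namespace EmbeddedGraph

variable {V D : Type*}

/-- The vertex to which a dart points. -/
def head (H : EmbeddedGraph V D) (d : D) : V := H.tail (H.rev d)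

/-- The next dart on the boundary of the face to the left of a dart. -/
def facePerm (H : EmbeddedGraph V D) : Equiv.Perm D := H.rot⁻¹ * H.rev

/-- Edges: pairs `{d, rev d}` of opposite darts. -/
def Edge (H : EmbeddedGraph V D) : Type _ := Quotient (Equiv.Perm.SameCycle.setoid H.rev)

/-- Faces: boundary walks with the face on the left. -/
def Face (H : EmbeddedGraph V D) : Type _ := Quotient (Equiv.Perm.SameCycle.setoid H.facePerm)

/-- The face to the left of a dart. The dart `d` also stands for the corner of this face at the
vertex `tail d`, so a face is adjacent to `v` iff it is `face d` for some `d` with `tail d = v`. -/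
def face (H : EmbeddedGraph V D) (d : D) : H.Face :=
  Quotient.mk (Equiv.Perm.SameCycle.setoid H.facePerm) d

/-- Any two vertices are joined by a walk. -/
def Connected (H : EmbeddedGraph V D) : Prop :=
  ∀ u v : V, Relation.ReflTransGen (fun a b => ∃ d, H.tail d = a ∧ H.head d = b) u v

/-- A connected embedded graph is planar if its surface is the sphere: `|V| - |E| + |F| = 2`. -/
def Planar (H : EmbeddedGraph V D) : Prop :=
  H.Connected ∧ Nat.card V + Nat.card H.Face = Nat.card H.Edge + 2

/-- The embedded dual. Its vertices are the faces. The dart `d` of the dual crosses the dart `d`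
from the face on its left to the face on its right; around a face, the dual darts follow each other
counterclockwise as the darts on the boundary of the face do. -/
def dual (H : EmbeddedGraph V D) : EmbeddedGraph H.Face D where
  tail := H.face
  rev := H.rev
  rot := H.facePerm
  rev_rev := H.rev_rev
  rev_ne := H.rev_ne
  tail_eq_iff := fun _ _ => Quotient.eq

/-! ### Paths and cycles, as lists of darts -/

/-- `p` is a walk from `u` to `v`. -/
def IsWalk (H : EmbeddedGraph V D) : V → List D → V → Prop
  | u, [], v => u = v
  | u, d :: p, v => H.tail d = u ∧ H.IsWalk (H.head d) p v

/-- `p` is a path (no repeated vertex) from `u` to `v`; it may be empty if `u = v`. -/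
def IsPath (H : EmbeddedGraph V D) (u : V) (p : List D) (v : V) : Prop :=
  H.IsWalk u p v ∧ (u :: p.map H.head).Nodup

/-- `c` is a (simple, oriented) cycle. Loops are cycles of length one, and two parallel edges form a
cycle of length two, but an edge followed by its reversal does not. -/
def IsCycle (H : EmbeddedGraph V D) (c : List D) : Prop :=
  c ≠ [] ∧ (∃ u, H.IsWalk u c u) ∧ (c.map H.tail).Nodup ∧ ∀ d ∈ c, H.rev d ∉ c

/-- The edge `{d, rev d}` lies on `c`. -/
def EdgeMem (H : EmbeddedGraph V D) (d : D) (c : List D) : Prop := d ∈ c ∨ H.rev d ∈ c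

/-- The total length of a path or cycle, for an edge length `w`. -/
def length (w : D → ℝ) (p : List D) : ℝ := (p.map w).sum

/-- `p` is a shortest path from `u` to `v`. -/
def IsShortestPath (H : EmbeddedGraph V D) (w : D → ℝ) (u : V) (p : List D) (v : V) : Prop :=
  H.IsPath u p v ∧ ∀ q, H.IsPath u q v → length w p ≤ length w q

/-! ### Separating cycles in the dual -/

/-- `c` is a cycle of the dual graph `G*` that separates `s` from `t`. The vertices of `G` are the
faces of `G*`; faces of `G*` that share an edge not on `c` lie on the same side of `c`, and `s`, `t`
are separated if such steps do not lead from `s` to `t`. -/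
def IsSeparatingCycle (G : EmbeddedGraph V D) (s t : V) (c : List D) : Prop :=
  G.dual.IsCycle c ∧
    ¬ Relation.ReflTransGen (fun a b => ∃ d, G.tail d = a ∧ G.head d = b ∧ ¬ G.EdgeMem d c) s t

/-- `c` is a shortest separating cycle. -/
def IsShortestSeparatingCycle (G : EmbeddedGraph V D) (w : D → ℝ) (s t : V) (c : List D) : Prop :=
  G.IsSeparatingCycle s t c ∧ ∀ c', G.IsSeparatingCycle s t c' → length w c ≤ length w c'

/-! ### Crossings -/

/-- The directions in which a curve may leave a vertex: along a dart, or into the corner that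
immediately precedes a dart in the counterclockwise order. -/
inductive Slot (D : Type*) where
  | dart (d : D) : Slot D
  | corner (d : D) : Slot D

/-- The counterclockwise order of all directions at a vertex. -/
def slotNext (H : EmbeddedGraph V D) : Slot D → Slot D
  | Slot.corner d => Slot.dart d
  | Slot.dart d => Slot.corner (H.rot d)

/-- Turning counterclockwise from `a`, one meets `x` strictly after `a` and strictly before `b`
(for distinct directions `a`, `b` at the same vertex). -/
def InArc (H : EmbeddedGraph V D) (a b x : Slot D) : Prop :=
  ∃ n, 0 < n ∧ H.slotNext^[n] a = x ∧ ∀ m, 0 < m → m ≤ n → H.slotNext^[m] a ≠ b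

/-- For a path `p`, extended by a dummy edge that comes in from the corner `k` at its first vertex
and a dummy edge that goes out to the corner `l` at its last vertex: the list over the vertices of
`p` of the pairs (direction from which the path comes in, direction in which it goes out). -/
def throughDirections (H : EmbeddedGraph V D) (k : D) (p : List D) (l : D) :
    List (Slot D × Slot D) :=
  (Slot.corner k :: p.map (fun d => Slot.dart (H.rev d))).zip (p.map Slot.dart ++ [Slot.corner l])

/-- The dart `x` leaves a vertex of the extended path, to the left of the path. -/
def LiesLeft (H : EmbeddedGraph V D) (k : D) (p : List D) (l : D) (x : D) : Prop :=
  ∃ ab ∈ H.throughDirections k p l, H.InArc ab.2 ab.1 (Slot.dart x)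

/-- The dart `x` leaves a vertex of the extended path, to the right of the path. -/
def LiesRight (H : EmbeddedGraph V D) (k : D) (p : List D) (l : D) (x : D) : Prop :=
  ∃ ab ∈ H.throughDirections k p l, H.InArc ab.1 ab.2 (Slot.dart x)

/-- `q` is a crossing between the cycle `c` and the extended path `p`: `q` consists of a first edge
`e`, a (possibly empty) run and a last edge `f`, which follow each other on `c` (and `e = f` is
possible, if this is the only edge of `c` outside the run); the run is a common subpath of `c` and
`p` (in either direction); and `e`, `f` lie on different sides of `p`. -/
def IsCrossing (H : EmbeddedGraph V D) (k : D) (p : List D) (l : D) (c q : List D) : Prop :=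
  ∃ (e : D) (run : List D) (f : D), q = e :: (run ++ [f]) ∧
    (∃ c₁ c₂ : List D, (e :: c₁) ~r c ∧ c₁ ++ [e] = run ++ f :: c₂) ∧
    (run <:+: p ∨ run <:+: (p.map H.rev).reverse) ∧
    ((H.LiesLeft k p l (H.rev e) ∧ H.LiesRight k p l f) ∨
      (H.LiesRight k p l (H.rev e) ∧ H.LiesLeft k p l f))

/-- The number of crossings between a cycle and an extended path. -/
noncomputable def numCrossings (H : EmbeddedGraph V D) (k : D) (p : List D) (l : D) (c : List D) :
    ℕ :=
  Set.ncard {q | H.IsCrossing k p l c q}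

end EmbeddedGraph

namespace EmbeddedGraph

variable {V D : Type*}

/-! ### Cocycles are coboundaries on the sphere -/

/-! Call a dual walk odd if an odd number of its edge ends lie to the left of the extended path. On
the sphere, a dual cycle separates `s` from `t` exactly when it is odd (`Planar.isSeparatingCycle`,
`IsSeparatingCycle.walkParity_eq_one`): its edge indicator mod 2 is the coboundary of a vertex
function φ, and summing a coboundary over the darts that leave the path to the left telescopes to
φ(s) + φ(t) (`sum_liesLeft`).

Cut a shortest separating cycle at its vertices on π. The pieces are edges of π, which are even, and
ears, which meet π only in their ends; hence some ear A is odd. Let R be the rest of the cycle and ρ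
the distance from the start of π. After reversing the cycle if necessary, A runs from a to b with ρ
b ≤ ρ a. Let q be the part of π from b to a. The cycle A + q is odd, and |q| = ρ a - ρ b ≤ |R|. So A
+ q is a shortest separating cycle, and |R| = ρ a - ρ b: the walk R is tight, that is, ρ grows along
it by exactly its length. As A + q crosses π once, the edges of A are settled.

An edge of R lies in a piece B of R, from b₁ to b₂ say. By tightness, b, b₁, b₂, a occur on π in
this order (`Planar.exists_single_crossing_of_isEar`). If B is an edge of π, it belongs to q. If B
is an even ear, it can replace the part m of q between b₁ and b₂; the result is again odd and
shortest, and crosses π once because A is odd and B even. If B is an odd ear, then B and m form an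
odd cycle of length 2|B|, while |A| + |R| ≥ 2|R|; hence R = B, and the original cycle consists of
two odd ears, so it is even, a contradiction. -/

theorem sameCycle_rev_iff (H : EmbeddedGraph V D) (d e : D) :
    H.rev.SameCycle d e ↔ e = d ∨ e = H.rev d := by
  constructor
  · rintro ⟨n, rfl⟩
    have h2 : H.rev * H.rev = 1 := Equiv.ext H.rev_rev
    obtain ⟨m, rfl | rfl⟩ := Int.even_or_odd' n
    · left
      rw [zpow_mul, zpow_two, h2, one_zpow]; rfl
    · right
      rw [zpow_add, zpow_mul, zpow_two, h2, one_zpow]; rfl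
  · rintro (rfl | rfl)
    · exact Equiv.Perm.SameCycle.refl _ _
    · exact ⟨1, rfl⟩

theorem tail_rot (H : EmbeddedGraph V D) (d : D) : H.tail (H.rot d) = H.tail d :=
  ((H.tail_eq_iff _ _).2 ⟨1, rfl⟩).symm

theorem head_rev (H : EmbeddedGraph V D) (d : D) : H.head (H.rev d) = H.tail d := by
  rw [head, H.rev_rev]

theorem tail_facePerm (H : EmbeddedGraph V D) (d : D) : H.tail (H.facePerm d) = H.head d := by
  rw [head, ← H.tail_rot (H.facePerm d)]
  simp [facePerm]

theorem face_facePerm (H : EmbeddedGraph V D) (d : D) : H.face (H.facePerm d) = H.face d :=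
  H.dual.tail_rot d

/-- A relation on darts that contains the steps `rev` and `facePerm` is total if the graph is
connected. -/
theorem Connected.dart_induction {H : EmbeddedGraph V D} (hH : H.Connected) (r : D → D → Prop)
    (hr : Equivalence r) (hrev : ∀ d, r d (H.rev d)) (hface : ∀ d, r d (H.facePerm d)) (d e : D) :
    r d e := by
  -- `facePerm (rev (rot d)) = d`, so the two kinds of step also connect the darts around a vertex.
  have hrot : ∀ d, r (H.rot d) d := by
    intro d
    have h1 := hface (H.rev (H.rot d))
    have h2 : H.facePerm (H.rev (H.rot d)) = d := by simp [facePerm, H.rev_rev]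
    rw [h2] at h1
    exact hr.trans (hrev _) h1
  have hcyc : ∀ d e, H.tail d = H.tail e → r d e := by
    intro d e h
    obtain ⟨n, rfl⟩ := (H.tail_eq_iff d e).1 h
    induction n using Int.induction_on with
    | zero => exact hr.refl _
    | succ n ih =>
      have := ih ((H.tail_eq_iff _ _).2 ⟨n, rfl⟩)
      refine hr.trans this (hr.symm ?_)
      rw [add_comm, zpow_one_add]
      exact hrot _
    | pred n ih =>
      have := ih ((H.tail_eq_iff _ _).2 ⟨-n, rfl⟩)
      refine hr.trans this ?_
      have h3 := hrot ((H.rot ^ (-(n : ℤ) - 1)) d)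
      rwa [← Equiv.Perm.mul_apply, ← zpow_one_add, add_sub_cancel] at h3
  have key : ∀ v, Relation.ReflTransGen (fun a b => ∃ d, H.tail d = a ∧ H.head d = b) (H.tail d) v →
      ∀ e, H.tail e = v → r d e := by
    intro v hv
    induction hv with
    | refl => exact fun e he => hcyc _ _ he.symm
    | tail _ hstep ih =>
      obtain ⟨x, hx, rfl⟩ := hstep
      exact fun e he => hr.trans (ih x hx) (hr.trans (hrev x) (hcyc _ _ he.symm))
  exact key _ (hH _ _) e rfl

open Classical in
/-- The coboundary of a vertex function sums to zero around every face. -/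
theorem sum_coboundary_face [Fintype D] (G : EmbeddedGraph V D) (φ : V → ZMod 2) (f : G.Face) :
    ∑ d with G.face d = f, (φ (G.tail d) + φ (G.head d)) = 0 := by
  rw [Finset.sum_add_distrib, CharTwo.add_eq_zero]
  symm
  refine Finset.sum_bij (fun d _ => G.facePerm d) ?_ ?_ ?_ ?_
  · intro d; simp [face_facePerm]
  · intro d _ e _ h; exact G.facePerm.injective h
  · intro d hd
    refine ⟨G.facePerm.symm d, ?_, by simp⟩
    have := G.face_facePerm (G.facePerm.symm d)
    rw [Equiv.apply_symm_apply] at this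
    simpa [← this] using hd
  · intro d _; rw [tail_facePerm]

open Classical in
/-- On the sphere, an edge function whose sum around every face vanishes is the coboundary of a
vertex function (with coefficients in `ZMod 2`). -/
theorem Planar.exists_potential [Finite V] [Fintype D] {G : EmbeddedGraph V D} (hG : G.Planar)
    (g : D → ZMod 2)
    (hrev : ∀ d, g (G.rev d) = g d) (hface : ∀ f : G.Face, ∑ d with G.face d = f, g d = 0) :
    ∃ φ : V → ZMod 2, ∀ d, g d = φ (G.tail d) + φ (G.head d) := by
  obtain ⟨hconn, heuler⟩ := hG
  by_cases hD : IsEmpty D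
  · exact ⟨0, fun d => hD.elim d⟩
  rw [not_isEmpty_iff] at hD
  obtain ⟨d₀⟩ := hD
  have : Fintype V := Fintype.ofFinite V
  have : Finite G.Face := inferInstanceAs (Finite (Quotient _))
  have : Finite G.Edge := inferInstanceAs (Finite (Quotient _))
  have : Fintype G.Face := Fintype.ofFinite _
  have : Fintype G.Edge := Fintype.ofFinite _
  let edge : D → G.Edge := Quotient.mk (Equiv.Perm.SameCycle.setoid G.rev)
  have hedge : ∀ d e, edge d = edge e ↔ e = d ∨ e = G.rev d := fun d e =>
    Quotient.eq.trans (G.sameCycle_rev_iff d e)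
  have hsurj : Function.Surjective edge := Quotient.mk_surjective
  -- `q` identifies edge functions with `rev`-invariant dart functions, so that the cocycles `ker (b
  -- ∘ₗ q)` are counted inside a space of dimension |E|.
  let q : (G.Edge → ZMod 2) →ₗ[ZMod 2] (D → ZMod 2) := LinearMap.funLeft _ _ edge
  have hq : Function.Injective q := LinearMap.funLeft_injective_of_surjective _ _ _ hsurj
  let b : (D → ZMod 2) →ₗ[ZMod 2] (G.Face → ZMod 2) :=
    LinearMap.pi fun f => ∑ d with G.face d = f, LinearMap.proj d
  have hb : ∀ h f, b h f = ∑ d with G.face d = f, h d := fun h f => by simp [b]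
  let δ : (V → ZMod 2) →ₗ[ZMod 2] (D → ZMod 2) :=
    LinearMap.funLeft _ _ G.tail + LinearMap.funLeft _ _ G.head
  have hδ : ∀ φ d, δ φ d = φ (G.tail d) + φ (G.head d) := fun φ d => rfl
  -- the coboundaries have dimension at least `|V| - 1`
  have hker : Module.finrank (ZMod 2) (LinearMap.ker δ) ≤ 1 := by
    have hle : LinearMap.ker δ ≤ Submodule.span (ZMod 2) {(fun _ => 1 : V → ZMod 2)} := by
      intro φ hφ
      rw [Submodule.mem_span_singleton]
      refine ⟨φ (G.tail d₀), funext fun v => ?_⟩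
      have hstep : ∀ v, Relation.ReflTransGen (fun a b => ∃ d, G.tail d = a ∧ G.head d = b)
          (G.tail d₀) v → φ (G.tail d₀) = φ v := by
        intro v hv
        induction hv with
        | refl => rfl
        | tail _ h ih =>
          obtain ⟨d, rfl, rfl⟩ := h
          have := congrFun (LinearMap.mem_ker.1 hφ) d
          rw [hδ] at this
          exact ih.trans (CharTwo.add_eq_zero.1 this)
      simpa using hstep v (hconn _ _)
    refine (Submodule.finrank_mono hle).trans ?_
    exact (finrank_span_le_card _).trans (by simp)
  have hrank := LinearMap.finrank_range_add_finrank_ker δ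
  rw [Module.finrank_fintype_fun_eq_card] at hrank
  have hdbl : ∀ x : G.Face → ZMod 2, x + x = 0 := fun x => funext fun f =>
    CharTwo.add_self_eq_zero (x f)
  -- the boundary map to the faces has rank at least `|F| - 1`
  have hsingle : ∀ d, b (q (Pi.single (edge d) 1)) =
      Pi.single (G.face d) 1 + Pi.single (G.face (G.rev d)) 1 := by
    intro d
    ext f
    rw [hb, Finset.sum_filter]
    have : ∀ x, (if G.face x = f then q (Pi.single (edge d) 1) x else 0 : ZMod 2) =
        (if x = d then (if G.face d = f then 1 else 0) else 0) +
        (if x = G.rev d then (if G.face (G.rev d) = f then 1 else 0) else 0) := by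
      intro x
      have hx : q (Pi.single (edge d) 1) x = if edge d = edge x then 1 else 0 := by
        simp [q, LinearMap.funLeft, Pi.single_apply, eq_comm]
      rw [hx, hedge]
      have := G.rev_ne d
      by_cases h1 : x = d
      · subst h1; simp [this.symm]
      · by_cases h2 : x = G.rev d
        · subst h2; simp [this]
        · simp [h1, h2]
    rw [Finset.sum_congr rfl fun x _ => this x]
    simp [Finset.sum_add_distrib, Pi.single_apply, eq_comm]
  -- The boundary of an edge is the sum of the indicators of its two faces; connectivity lets any
  -- face be reached from `d₀`.
  have hrange : ∀ d, (Pi.single (G.face d₀) 1 + Pi.single (G.face d) 1 : G.Face → ZMod 2) ∈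
      LinearMap.range (b ∘ₗ q) := by
    intro d
    refine hconn.dart_induction (fun d e => (Pi.single (G.face d) 1 + Pi.single (G.face e) 1 :
      G.Face → ZMod 2) ∈ LinearMap.range (b ∘ₗ q)) ⟨?_, ?_, ?_⟩ ?_ ?_ d₀ d
    · intro d; rw [hdbl]; exact zero_mem _
    · intro d e h; rwa [add_comm]
    · intro x y z hxy hyz
      have := add_mem hxy hyz
      rwa [add_assoc, ← add_assoc (Pi.single (G.face y) 1 : G.Face → ZMod 2),
        hdbl, zero_add] at this
    · intro d; exact ⟨_, hsingle d⟩
    · intro d; rw [face_facePerm, hdbl]; exact zero_mem _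
  have hsup : LinearMap.range (b ∘ₗ q) ⊔
      Submodule.span (ZMod 2) {(Pi.single (G.face d₀) 1 : G.Face → ZMod 2)} = ⊤ := by
    rw [eq_top_iff]
    intro x _
    rw [pi_eq_sum_univ' x]
    refine sum_mem fun f _ => Submodule.smul_mem _ _ ?_
    obtain ⟨d, rfl⟩ : ∃ d, G.face d = f := Quotient.mk_surjective f
    have h1 := Submodule.mem_sup_left (T := Submodule.span (ZMod 2)
      {(Pi.single (G.face d₀) 1 : G.Face → ZMod 2)}) (hrange d)
    have h2 := Submodule.mem_sup_right (S := LinearMap.range (b ∘ₗ q))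
      (Submodule.mem_span_singleton_self (R := ZMod 2)
        (Pi.single (G.face d₀) 1 : G.Face → ZMod 2))
    have h3 := add_mem h2 h1
    rw [← add_assoc, hdbl, zero_add] at h3
    convert h3
  have hrank2 := Submodule.finrank_add_le_finrank_add_finrank (LinearMap.range (b ∘ₗ q))
    (Submodule.span (ZMod 2) {(Pi.single (G.face d₀) 1 : G.Face → ZMod 2)})
  have h1 := finrank_span_le_card (R := ZMod 2) {(Pi.single (G.face d₀) 1 : G.Face → ZMod 2)}
  rw [hsup, finrank_top, Module.finrank_fintype_fun_eq_card] at hrank2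
  have hrank3 := LinearMap.finrank_range_add_finrank_ker (b ∘ₗ q)
  rw [Module.finrank_fintype_fun_eq_card] at hrank3
  have hmap := (Submodule.equivMapOfInjective q hq (LinearMap.ker (b ∘ₗ q))).finrank_eq
  simp only [Nat.card_eq_fintype_card] at heuler
  simp only [Set.toFinset_singleton, Finset.card_singleton] at h1
  -- coboundaries are cocycles
  have hle : LinearMap.range δ ≤ (LinearMap.ker (b ∘ₗ q)).map q := by
    rintro _ ⟨φ, rfl⟩
    have hlift : ∀ x y, (Equiv.Perm.SameCycle.setoid G.rev) x y →
        φ (G.tail x) + φ (G.head x) = φ (G.tail y) + φ (G.head y) := by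
      intro x y hxy
      rcases (G.sameCycle_rev_iff x y).1 hxy with rfl | rfl
      · rfl
      · rw [head_rev, add_comm]; rfl
    refine ⟨fun x => Quotient.lift (fun d => φ (G.tail d) + φ (G.head d)) hlift x, ?_, rfl⟩
    rw [SetLike.mem_coe, LinearMap.mem_ker]
    ext f
    rw [LinearMap.comp_apply, hb]
    exact G.sum_coboundary_face φ f
  -- Cocycles have dimension at most |E| - (|F| - 1), which by Euler's formula is |V| - 1, and
  -- coboundaries have at least this dimension.
  have heq := Submodule.eq_of_le_of_finrank_le hle (by omega)
  have hg : g ∈ (LinearMap.ker (b ∘ₗ q)).map q := by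
    have hlift : ∀ x y, (Equiv.Perm.SameCycle.setoid G.rev) x y → g x = g y := by
      intro x y hxy
      rcases (G.sameCycle_rev_iff x y).1 hxy with rfl | rfl
      · rfl
      · rw [hrev]
    refine ⟨fun x => Quotient.lift g hlift x, ?_, rfl⟩
    rw [SetLike.mem_coe, LinearMap.mem_ker]
    ext f
    rw [LinearMap.comp_apply, hb]
    exact hface f
  rw [← heq] at hg
  obtain ⟨φ, rfl⟩ := hg
  exact ⟨φ, hδ φ⟩

/-! ### The cyclic order of the directions at a vertex -/

/-- The vertex at which a direction is based. -/
def slotTail (H : EmbeddedGraph V D) : Slot D → V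
  | Slot.dart d => H.tail d
  | Slot.corner d => H.tail d

theorem slotTail_slotNext (H : EmbeddedGraph V D) (a : Slot D) :
    H.slotTail (H.slotNext a) = H.slotTail a := by
  cases a
  · exact H.tail_rot _
  · rfl

theorem slotTail_iterate (H : EmbeddedGraph V D) (a : Slot D) (n : ℕ) :
    H.slotTail (H.slotNext^[n] a) = H.slotTail a := by
  induction n with
  | zero => rfl
  | succ n ih => rw [Function.iterate_succ_apply', slotTail_slotNext, ih]

theorem slotNext_injective (H : EmbeddedGraph V D) : Function.Injective H.slotNext := by
  rintro (a | a) (b | b) h <;> simp_all [slotNext]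

theorem iterate_slotNext_cancel (H : EmbeddedGraph V D) {a b : Slot D} {m n : ℕ} (hmn : m ≤ n)
    (h : H.slotNext^[n] a = H.slotNext^[m] b) : H.slotNext^[n - m] a = b := by
  apply (H.slotNext_injective.iterate m)
  rw [← Function.iterate_add_apply, Nat.add_sub_cancel' hmn, h]

theorem iterate_slotNext_dart (H : EmbeddedGraph V D) (d : D) (n : ℕ) :
    H.slotNext^[2 * n] (Slot.dart d) = Slot.dart (H.rot^[n] d) := by
  induction n with
  | zero => rfl
  | succ n ih =>
    rw [Nat.mul_succ, Function.iterate_succ_apply', Function.iterate_succ_apply', ih,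
      Function.iterate_succ_apply']
    rfl

/-- Turning counterclockwise, one meets all directions at the same vertex. -/
theorem exists_iterate_slotNext [Finite D] (H : EmbeddedGraph V D) {a b : Slot D}
    (hab : H.slotTail a = H.slotTail b) : ∃ n, 0 < n ∧ H.slotNext^[n] a = b := by
  have hdart : ∀ d e, H.tail d = H.tail e →
      ∃ n, 0 < n ∧ H.slotNext^[n] (Slot.dart d) = Slot.dart e := by
    intro d e h
    obtain ⟨n, hn, -, h2⟩ := ((H.tail_eq_iff d e).1 h).exists_pow_eq''
    refine ⟨2 * n, by omega, ?_⟩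
    rw [iterate_slotNext_dart, ← h2, Equiv.Perm.iterate_eq_pow]
  have hcorner : ∀ d b, H.tail d = H.slotTail b →
      ∃ n, 0 < n ∧ H.slotNext^[n] (Slot.dart d) = b := by
    rintro d (e | e) h
    · exact hdart d e h
    · obtain ⟨n, hn, h2⟩ := hdart d e h
      -- The corner at `e` comes one step before the dart `e`. The case `n = 1` is impossible,
      -- because one step from a dart leads to a corner.
      refine ⟨n - 1, ?_, ?_⟩
      · rcases n with _ | _ | n
        · omega
        · cases h2
        · omega
      · apply H.slotNext_injective
        rw [← Function.iterate_succ_apply' (f := H.slotNext), Nat.succ_eq_add_one,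
          Nat.sub_add_cancel hn, h2]
        rfl
  rcases a with d | d
  · exact hcorner d b hab
  · obtain ⟨n, hn, h2⟩ := hcorner d b hab
    exact ⟨n + 1, n.succ_pos, h2⟩

theorem InArc.slotTail_eq {H : EmbeddedGraph V D} {a b x : Slot D} (h : H.InArc a b x) :
    H.slotTail x = H.slotTail a := by
  obtain ⟨n, -, rfl, -⟩ := h
  exact H.slotTail_iterate a n

theorem not_inArc_right (H : EmbeddedGraph V D) (a b : Slot D) : ¬ H.InArc a b b := by
  rintro ⟨n, hn, h, h2⟩
  exact h2 n hn le_rfl h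

/-- A turn that returns to `a` is a multiple of the period, so it has passed every direction at the
vertex, `b` included. -/
theorem not_inArc_left [Finite D] (H : EmbeddedGraph V D) {a b : Slot D} (hne : a ≠ b)
    (hab : H.slotTail a = H.slotTail b) : ¬ H.InArc a b a := by
  rintro ⟨n, hn, h, h2⟩
  obtain ⟨m, -, hm⟩ := H.exists_iterate_slotNext hab
  have hper : Function.IsPeriodicPt H.slotNext n a := h
  rw [← hper.iterate_mod_apply m] at hm
  rcases Nat.eq_zero_or_pos (m % n) with h0 | h0
  · rw [h0] at hm; exact hne hm
  · exact h2 _ h0 (Nat.mod_lt _ hn).le hm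

theorem InArc.not_inArc {H : EmbeddedGraph V D} {a b x : Slot D} (hne : a ≠ b)
    (h : H.InArc a b x) : ¬ H.InArc b a x := by
  obtain ⟨n, hn, rfl, h2⟩ := h
  rintro ⟨m, hm, h3, h4⟩
  rcases lt_trichotomy n m with hlt | rfl | hlt
  · exact h4 (m - n) (by omega) (by omega) (H.iterate_slotNext_cancel hlt.le h3)
  · exact hne ((H.slotNext_injective.iterate n) h3.symm)
  · exact h2 (n - m) (by omega) (by omega) (H.iterate_slotNext_cancel hlt.le h3.symm)

/-- Turn from `a` until `x` is first met. Either `b` was not passed, or the part of the turn after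
`b` leads to `x`; that part avoids `a`, since otherwise `x` would have been met sooner. -/
theorem inArc_or_inArc [Finite D] (H : EmbeddedGraph V D) {a b x : Slot D}
    (hx : H.slotTail x = H.slotTail a) (hxa : x ≠ a) (hxb : x ≠ b) :
    H.InArc a b x ∨ H.InArc b a x := by
  classical
  have hex := H.exists_iterate_slotNext hx.symm
  obtain ⟨hn, hnx⟩ := Nat.find_spec hex
  have hmin : ∀ m, 0 < m → m < Nat.find hex → H.slotNext^[m] a ≠ x := fun m hm hlt h =>
    Nat.find_min hex hlt ⟨hm, h⟩
  set n := Nat.find hex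
  by_cases hall : ∀ m, 0 < m → m ≤ n → H.slotNext^[m] a ≠ b
  · exact Or.inl ⟨n, hn, hnx, hall⟩
  · push Not at hall
    obtain ⟨m, hm, hmn, rfl⟩ := hall
    have hlt : m < n := lt_of_le_of_ne hmn fun h => hxb (by rw [h, hnx])
    refine Or.inr ⟨n - m, by omega, ?_, ?_⟩
    · rw [← Function.iterate_add_apply, Nat.sub_add_cancel hmn, hnx]
    · intro j hj hjn h
      rw [← Function.iterate_add_apply] at h
      have h5 : H.slotNext^[n - (j + m)] a = x := by
        rw [← hnx]
        conv_lhs => rw [← h]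
        rw [← Function.iterate_add_apply, Nat.sub_add_cancel (by omega)]
      rcases Nat.eq_zero_or_pos (n - (j + m)) with h0 | h0
      · rw [h0] at h5; exact hxa h5.symm
      · exact hmin _ h0 (by omega) h5

open Classical in
/-- Summation by parts over an arc. -/
theorem sum_inArc [Fintype D] (H : EmbeddedGraph V D) (α ψ : Slot D → ZMod 2)
    (hα : ∀ y, α (H.slotNext y) = ψ y) (hcorner : ∀ d, α (Slot.corner d) = ψ (Slot.corner d))
    {a b : Slot D} (hab : H.slotTail a = H.slotTail b) :
    ∑ x with H.InArc a b (Slot.dart x), (α (Slot.dart x) + ψ (Slot.dart x)) = ψ a + α b := by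
  have hex := H.exists_iterate_slotNext hab
  obtain ⟨hN, hNb⟩ := Nat.find_spec hex
  have hmin : ∀ m, 0 < m → m < Nat.find hex → H.slotNext^[m] a ≠ b := fun m hm hlt h =>
    Nat.find_min hex hlt ⟨hm, h⟩
  set N := Nat.find hex
  have hiff : ∀ x, H.InArc a b x ↔ ∃ n, 0 < n ∧ n < N ∧ H.slotNext^[n] a = x := by
    intro x
    constructor
    · rintro ⟨n, hn, hx, h⟩
      refine ⟨n, hn, ?_, hx⟩
      by_contra hlt
      exact h N hN (by omega) hNb
    · rintro ⟨n, hn, hlt, hx⟩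
      exact ⟨n, hn, hx, fun m hm hmn => hmin m hm (by omega)⟩
  have hinj : Set.InjOn (fun n => H.slotNext^[n] a) (Finset.Ioo 0 N) := by
    have key : ∀ i j, 0 < i → i < j → j < N → H.slotNext^[i] a ≠ H.slotNext^[j] a := by
      intro i j hi hij hj h
      apply hmin (N - j + i) (by omega) (by omega)
      rw [Function.iterate_add_apply, h, ← Function.iterate_add_apply,
        Nat.sub_add_cancel hj.le, hNb]
    intro i hi j hj h
    simp only [Finset.coe_Ioo, Set.mem_Ioo] at hi hj
    rcases lt_trichotomy i j with hlt | rfl | hlt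
    · exact (key i j hi.1 hlt hj.2 h).elim
    · rfl
    · exact (key j i hj.1 hlt hi.2 h.symm).elim
  -- The sum may run over all directions of the arc, since corners contribute zero by `hcorner`.
  have h1 : ∑ x with H.InArc a b (Slot.dart x), (α (Slot.dart x) + ψ (Slot.dart x)) =
      ∑ y ∈ (Finset.Ioo 0 N).image (fun n => H.slotNext^[n] a), (α y + ψ y) := by
    refine Finset.sum_of_injOn Slot.dart ?_ ?_ ?_ ?_
    · intro x _ y _ h; exact Slot.dart.inj h
    · intro x hx
      simp only [Finset.coe_filter, Finset.mem_univ, true_and, Set.mem_ofPred_eq] at hx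
      obtain ⟨n, hn, hlt, h⟩ := (hiff _).1 hx
      simp only [Finset.coe_image, Set.mem_image, Finset.coe_Ioo, Set.mem_Ioo]
      exact ⟨n, ⟨hn, hlt⟩, h⟩
    · rintro (y | y) hy hny
      · refine (hny ⟨y, ?_, rfl⟩).elim
        simp only [Finset.mem_image, Finset.mem_Ioo] at hy
        obtain ⟨n, ⟨hn, hlt⟩, h⟩ := hy
        simpa using (hiff _).2 ⟨n, hn, hlt, h⟩
      · rw [hcorner, CharTwo.add_self_eq_zero]
    · intro x _; rfl
  rw [h1, Finset.sum_image hinj]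
  -- Telescoping: by `hα`, the `ψ` of one direction cancels the `α` of the next.
  have h2 : ∀ n, ∑ i ∈ Finset.Ioo 0 (n + 1), (α (H.slotNext^[i] a) + ψ (H.slotNext^[i] a)) =
      ψ a + α (H.slotNext^[n + 1] a) := by
    intro n
    induction n with
    | zero =>
      rw [Function.iterate_one, hα, CharTwo.add_self_eq_zero]
      rfl
    | succ n ih =>
      have : Finset.Ioo 0 (n + 1 + 1) = insert (n + 1) (Finset.Ioo 0 (n + 1)) := by
        ext i; simp only [Finset.mem_Ioo, Finset.mem_insert]; omega
      rw [this, Finset.sum_insert (by simp), ih, Function.iterate_succ_apply' _ (n + 1), hα]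
      generalize α (H.slotNext^[n + 1] a) = y
      rw [add_comm y, add_comm (ψ a), add_assoc, ← add_assoc y, CharTwo.add_self_eq_zero, zero_add,
        add_comm]
  have h3 := h2 (N - 1)
  rwa [Nat.sub_add_cancel hN, hNb] at h3

/-! ### Directions of an extended path -/

/-- `throughDirections` for a path that comes in from an arbitrary direction. -/
def through (H : EmbeddedGraph V D) : Slot D → List D → D → List (Slot D × Slot D)
  | a, [], l => [(a, Slot.corner l)]
  | a, d :: p, l => (a, Slot.dart d) :: H.through (Slot.dart (H.rev d)) p l

theorem throughDirections_eq (H : EmbeddedGraph V D) (k : D) (p : List D) (l : D) :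
    H.throughDirections k p l = H.through (Slot.corner k) p l := by
  have : ∀ a, (a :: p.map (fun d => Slot.dart (H.rev d))).zip (p.map Slot.dart ++ [Slot.corner l]) =
      H.through a p l := by
    induction p with
    | nil => intro a; rfl
    | cons d p ih => intro a; simp [through, ih]
  exact this _

theorem IsWalk.append {H : EmbeddedGraph V D} {u v w : V} {p q : List D} (hp : H.IsWalk u p v)
    (hq : H.IsWalk v q w) : H.IsWalk u (p ++ q) w := by
  induction p generalizing u with
  | nil => cases hp; exact hq
  | cons d p ih => exact ⟨hp.1, ih hp.2⟩

theorem isWalk_append {H : EmbeddedGraph V D} {u w : V} {p q : List D} :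
    H.IsWalk u (p ++ q) w ↔ ∃ v, H.IsWalk u p v ∧ H.IsWalk v q w := by
  refine ⟨fun h => ?_, fun ⟨v, hp, hq⟩ => hp.append hq⟩
  induction p generalizing u with
  | nil => exact ⟨u, rfl, h⟩
  | cons d p ih =>
    obtain ⟨v, hv, hq⟩ := ih h.2
    exact ⟨v, ⟨h.1, hv⟩, hq⟩

theorem IsWalk.map_tail_append {H : EmbeddedGraph V D} {u v : V} {p : List D}
    (hp : H.IsWalk u p v) : p.map H.tail ++ [v] = u :: p.map H.head := by
  induction p generalizing u with
  | nil => cases hp; rfl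
  | cons d p ih => simp [ih hp.2, hp.1]

theorem map_slotTail_through (H : EmbeddedGraph V D) {u v : V} {p : List D} (hp : H.IsWalk u p v)
    {a : Slot D} (ha : H.slotTail a = u) (l : D) :
    (H.through a p l).map (fun ab => H.slotTail ab.1) = u :: p.map H.head := by
  induction p generalizing u a with
  | nil => simp [through, ha]
  | cons d p ih =>
    simp only [through, List.map_cons, ha]
    rw [ih hp.2 rfl]

theorem slotTail_eq_of_mem_through (H : EmbeddedGraph V D) {u v : V} {p : List D}
    (hp : H.IsWalk u p v) {a : Slot D} (ha : H.slotTail a = u) {l : D} (hl : H.tail l = v)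
    {ab : Slot D × Slot D} (hab : ab ∈ H.through a p l) : H.slotTail ab.1 = H.slotTail ab.2 := by
  induction p generalizing u a with
  | nil =>
    cases hp
    simp only [through, List.mem_singleton] at hab
    subst hab
    exact ha.trans hl.symm
  | cons d p ih =>
    rcases List.mem_cons.1 hab with rfl | h
    · exact ha.trans hp.1.symm
    · exact ih hp.2 rfl h

/-- Leaving a vertex along the edge just used would revisit the previous vertex. The hypotheses on
`a` treat the first vertex, where the incoming direction is arbitrary. -/
theorem ne_of_mem_through (H : EmbeddedGraph V D) {u v : V} {p : List D} (hp : H.IsPath u p v)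
    {a : Slot D} {l : D} (hal : a ≠ Slot.corner l) (had : ∀ d ∈ p.head?, a ≠ Slot.dart d)
    {ab : Slot D × Slot D} (hab : ab ∈ H.through a p l) : ab.1 ≠ ab.2 := by
  induction p generalizing u a with
  | nil =>
    simp only [through, List.mem_singleton] at hab
    subst hab
    exact hal
  | cons d p ih =>
    rcases List.mem_cons.1 hab with rfl | h
    · exact had d rfl
    · refine ih ⟨hp.1.2, (List.nodup_cons.1 hp.2).2⟩ (by simp) ?_ h
      intro e he heq
      have heq := Slot.dart.inj heq
      subst heq
      refine (List.nodup_cons.1 hp.2).1 ?_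
      rw [← hp.1.1, List.map_cons]
      refine List.mem_cons_of_mem _ ?_
      rw [← H.head_rev d]
      exact List.mem_map_of_mem (List.mem_of_mem_head? he)

theorem exists_mem_through_snd (H : EmbeddedGraph V D) (a : Slot D) {p : List D} (l : D) {x : D}
    (hx : x ∈ p) : ∃ ab ∈ H.through a p l, ab.2 = Slot.dart x := by
  induction p generalizing a with
  | nil => cases hx
  | cons d p ih =>
    rcases List.mem_cons.1 hx with rfl | h
    · exact ⟨_, List.mem_cons_self, rfl⟩
    · obtain ⟨ab, h1, h2⟩ := ih _ h
      exact ⟨ab, List.mem_cons_of_mem _ h1, h2⟩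

theorem exists_mem_through_fst (H : EmbeddedGraph V D) (a : Slot D) {p : List D} (l : D) {x : D}
    (hx : x ∈ p) : ∃ ab ∈ H.through a p l, ab.1 = Slot.dart (H.rev x) := by
  induction p generalizing a with
  | nil => cases hx
  | cons d p ih =>
    rcases List.mem_cons.1 hx with rfl | h
    · refine ⟨(Slot.dart (H.rev x), (p.map Slot.dart ++ [Slot.corner l]).head (by simp)), ?_, rfl⟩
      refine List.mem_cons_of_mem _ ?_
      cases p <;> exact List.mem_cons_self
    · obtain ⟨ab, h1, h2⟩ := ih _ h
      exact ⟨ab, List.mem_cons_of_mem _ h1, h2⟩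

theorem mem_of_mem_through (H : EmbeddedGraph V D) {a : Slot D} {p : List D} {l x : D}
    {ab : Slot D × Slot D} (hab : ab ∈ H.through a p l) :
    (ab.1 = Slot.dart x → a = Slot.dart x ∨ H.rev x ∈ p) ∧ (ab.2 = Slot.dart x → x ∈ p) := by
  induction p generalizing a with
  | nil =>
    simp only [through, List.mem_singleton] at hab
    subst hab
    exact ⟨Or.inl, fun h => by cases h⟩
  | cons d p ih =>
    rcases List.mem_cons.1 hab with rfl | h
    · exact ⟨Or.inl, fun h => by rw [Slot.dart.inj h]; exact List.mem_cons_self⟩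
    · refine ⟨fun h1 => Or.inr ?_, fun h1 => List.mem_cons_of_mem _ ((ih h).2 h1)⟩
      rcases (ih h).1 h1 with h2 | h2
      · rw [← Slot.dart.inj h2, H.rev_rev]; exact List.mem_cons_self
      · exact List.mem_cons_of_mem _ h2

/-! ### The two sides of an extended path -/

/-- A path together with corners at its ends through which it is extended. -/
structure IsExtendedPath (H : EmbeddedGraph V D) (u : V) (k : D) (p : List D) (l : D) (v : V) :
    Prop where
  isPath : H.IsPath u p v
  tail_in : H.tail k = u
  tail_out : H.tail l = v
  ne : k ≠ l

section Sides

variable {H : EmbeddedGraph V D} {u v : V} {k l : D} {p : List D}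

theorem IsExtendedPath.slotTail_eq (h : H.IsExtendedPath u k p l v) {ab : Slot D × Slot D}
    (hab : ab ∈ H.throughDirections k p l) : H.slotTail ab.1 = H.slotTail ab.2 := by
  rw [throughDirections_eq] at hab
  exact H.slotTail_eq_of_mem_through h.isPath.1 (a := Slot.corner k) h.tail_in h.tail_out hab

theorem IsExtendedPath.fst_ne_snd (h : H.IsExtendedPath u k p l v) {ab : Slot D × Slot D}
    (hab : ab ∈ H.throughDirections k p l) : ab.1 ≠ ab.2 := by
  rw [throughDirections_eq] at hab
  exact H.ne_of_mem_through h.isPath (by simpa using h.ne) (by simp) hab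

theorem IsExtendedPath.map_slotTail (h : H.IsExtendedPath u k p l v) :
    (H.throughDirections k p l).map (fun ab => H.slotTail ab.1) = u :: p.map H.head := by
  rw [throughDirections_eq]
  exact H.map_slotTail_through h.isPath.1 (a := Slot.corner k) h.tail_in l

/-- The base vertices of the pairs are the vertices of the path, without repetition. This reduces
questions about the sides of the path to a single vertex. -/
theorem IsExtendedPath.eq_of_slotTail (h : H.IsExtendedPath u k p l v) {ab ab' : Slot D × Slot D}
    (hab : ab ∈ H.throughDirections k p l) (hab' : ab' ∈ H.throughDirections k p l)
    (heq : H.slotTail ab.1 = H.slotTail ab'.1) : ab = ab' :=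
  List.inj_on_of_nodup_map (f := fun ab => H.slotTail ab.1)
    (by rw [h.map_slotTail]; exact h.isPath.2) hab hab' heq

theorem IsExtendedPath.slotTail_mem (h : H.IsExtendedPath u k p l v) {ab : Slot D × Slot D}
    (hab : ab ∈ H.throughDirections k p l) : H.slotTail ab.1 ∈ u :: p.map H.head := by
  rw [← h.map_slotTail]
  exact List.mem_map_of_mem (f := fun ab => H.slotTail ab.1) hab

theorem IsExtendedPath.tail_mem_of_liesLeft (h : H.IsExtendedPath u k p l v) {x : D}
    (hx : H.LiesLeft k p l x) : H.tail x ∈ u :: p.map H.head := by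
  obtain ⟨ab, hab, harc⟩ := hx
  have : H.tail x = H.slotTail ab.1 := harc.slotTail_eq.trans (h.slotTail_eq hab).symm
  exact this ▸ h.slotTail_mem hab

theorem IsExtendedPath.tail_mem_of_liesRight (h : H.IsExtendedPath u k p l v) {x : D}
    (hx : H.LiesRight k p l x) : H.tail x ∈ u :: p.map H.head := by
  obtain ⟨ab, hab, harc⟩ := hx
  exact (show H.tail x = H.slotTail ab.1 from harc.slotTail_eq) ▸ h.slotTail_mem hab

theorem IsExtendedPath.not_liesRight (h : H.IsExtendedPath u k p l v) {x : D}
    (hx : H.LiesLeft k p l x) : ¬ H.LiesRight k p l x := by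
  obtain ⟨ab, hab, harc⟩ := hx
  rintro ⟨ab', hab', harc'⟩
  have h1 := harc.slotTail_eq
  rw [← h.slotTail_eq hab, harc'.slotTail_eq] at h1
  cases h.eq_of_slotTail hab' hab h1
  exact harc.not_inArc (h.fst_ne_snd hab).symm harc'

theorem IsExtendedPath.liesLeft_or_liesRight [Finite D] (h : H.IsExtendedPath u k p l v) {x : D}
    (hx : H.tail x ∈ u :: p.map H.head) (hxp : ¬ H.EdgeMem x p) :
    H.LiesLeft k p l x ∨ H.LiesRight k p l x := by
  rw [← h.map_slotTail] at hx
  obtain ⟨ab, hab, htail⟩ := List.mem_map.1 hx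
  have hab2 := hab
  rw [throughDirections_eq] at hab2
  have h1 := H.mem_of_mem_through (x := x) hab2
  have h2 : Slot.dart x ≠ ab.1 := fun heq => by
    rcases h1.1 heq.symm with h3 | h3
    · cases h3
    · exact hxp (Or.inr h3)
  have h3 : Slot.dart x ≠ ab.2 := fun heq => hxp (Or.inl (h1.2 heq.symm))
  rcases H.inArc_or_inArc (show H.slotTail (Slot.dart x) = _ from htail.symm) h2 h3 with h4 | h4
  · exact Or.inr ⟨ab, hab, h4⟩
  · exact Or.inl ⟨ab, hab, h4⟩

/-- Such a dart is itself the incoming or outgoing direction at its vertex, and arcs exclude both of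
their ends. -/
theorem IsExtendedPath.not_inArc_of_edgeMem [Finite D] (h : H.IsExtendedPath u k p l v) {x : D}
    (hxp : H.EdgeMem x p) {ab : Slot D × Slot D} (hab : ab ∈ H.throughDirections k p l) :
    ¬ H.InArc ab.1 ab.2 (Slot.dart x) ∧ ¬ H.InArc ab.2 ab.1 (Slot.dart x) := by
  have hne := h.fst_ne_snd hab
  have htail := h.slotTail_eq hab
  have key : ∀ ab' ∈ H.throughDirections k p l, (ab'.1 = Slot.dart x ∨ ab'.2 = Slot.dart x) →
      ¬ H.InArc ab.1 ab.2 (Slot.dart x) ∧ ¬ H.InArc ab.2 ab.1 (Slot.dart x) := by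
    intro ab' hab' hx
    have hx' : H.slotTail (Slot.dart x) = H.slotTail ab'.1 := by
      rcases hx with hx | hx
      · rw [hx]
      · rw [h.slotTail_eq hab', hx]
    by_cases heq : ab' = ab
    · subst heq
      rcases hx with hx | hx <;> rw [← hx]
      · exact ⟨H.not_inArc_left hne htail, H.not_inArc_right _ _⟩
      · exact ⟨H.not_inArc_right _ _, H.not_inArc_left hne.symm htail.symm⟩
    · constructor
      · intro harc
        exact heq (h.eq_of_slotTail hab' hab (hx'.symm.trans harc.slotTail_eq))
      · intro harc
        exact heq (h.eq_of_slotTail hab' hab (hx'.symm.trans (harc.slotTail_eq.trans htail.symm)))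
  rcases hxp with hx | hx
  · obtain ⟨ab', h1, h2⟩ := H.exists_mem_through_snd (Slot.corner k) l hx
    rw [← throughDirections_eq] at h1
    exact key ab' h1 (Or.inr h2)
  · obtain ⟨ab', h1, h2⟩ := H.exists_mem_through_fst (Slot.corner k) l hx
    rw [← throughDirections_eq] at h1
    rw [H.rev_rev] at h2
    exact key ab' h1 (Or.inl h2)

theorem IsExtendedPath.not_liesLeft [Finite D] (h : H.IsExtendedPath u k p l v) {x : D}
    (hxp : H.EdgeMem x p) : ¬ H.LiesLeft k p l x :=
  fun ⟨_, hab, harc⟩ => (h.not_inArc_of_edgeMem hxp hab).2 harc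

theorem IsExtendedPath.not_liesRight_of_edgeMem [Finite D] (h : H.IsExtendedPath u k p l v) {x : D}
    (hxp : H.EdgeMem x p) : ¬ H.LiesRight k p l x :=
  fun ⟨_, hab, harc⟩ => (h.not_inArc_of_edgeMem hxp hab).1 harc

end Sides

open Classical in
/-- The coboundary of a vertex function `φ`, summed over the darts that leave a dual path to the
left, is the sum of the values of `φ` at the ends of the extended path. -/
theorem sum_liesLeft [Fintype D] {G : EmbeddedGraph V D} {u v : G.Face} {k l : D} {p : List D}
    (h : G.dual.IsExtendedPath u k p l v) (φ : V → ZMod 2) :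
    ∑ x with G.dual.LiesLeft k p l x, (φ (G.tail x) + φ (G.head x)) =
      φ (G.tail k) + φ (G.tail l) := by
  -- Turning around a face of `G`, a direction passes from one vertex on its boundary to the next:
  -- `α` and `ψ` are the values of `φ` just before and just after it. A corner stays at one vertex.
  let α : Slot D → ZMod 2
    | Slot.dart d => φ (G.tail d)
    | Slot.corner d => φ (G.tail d)
  let ψ : Slot D → ZMod 2
    | Slot.dart d => φ (G.head d)
    | Slot.corner d => φ (G.tail d)
  have hα : ∀ y, α (G.dual.slotNext y) = ψ y := by
    rintro (d | d)
    · exact congrArg φ (G.tail_facePerm d)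
    · rfl
  have hsum : ∀ {a b : Slot D}, G.dual.slotTail a = G.dual.slotTail b →
      ∑ x with G.dual.InArc a b (Slot.dart x), (φ (G.tail x) + φ (G.head x)) = ψ a + α b :=
    fun hab => G.dual.sum_inArc α ψ hα (fun _ => rfl) hab
  have key : ∀ (p : List D) (u : G.Face) (a : Slot D), G.dual.IsPath u p v →
      G.dual.slotTail a = u →
      ∑ x with ∃ ab ∈ G.dual.through a p l, G.dual.InArc ab.2 ab.1 (Slot.dart x),
        (φ (G.tail x) + φ (G.head x)) = α a + φ (G.tail l) := by
    intro p
    induction p with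
    | nil =>
      intro u a hp ha
      have hab : G.dual.slotTail (Slot.corner l) = G.dual.slotTail a :=
        h.tail_out.trans ((show u = v from hp.1).symm.trans ha.symm)
      have := hsum hab
      rw [add_comm] at this
      simpa [through] using this
    | cons d p ih =>
      intro u a hp ha
      have hp' : G.dual.IsPath (G.dual.head d) p v := ⟨hp.1.2, (List.nodup_cons.1 hp.2).2⟩
      have h1 := ih _ (Slot.dart (G.rev d)) hp' rfl
      have h2 := hsum (a := Slot.dart d) (b := a) (hp.1.1.trans ha.symm)
      simp only [through, List.mem_cons, exists_eq_or_imp]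
      rw [Finset.filter_or, Finset.sum_union, h2]
      · erw [h1]
        -- The end `head d` of the crossed edge bounds the left arcs at both ends of the dual dart
        -- `d`, so its value occurs twice and cancels.
        change φ (G.head d) + α a + (φ (G.head d) + _) = _
        rw [add_comm (φ (G.head d)), add_assoc, ← add_assoc (φ (G.head d)),
          CharTwo.add_self_eq_zero, zero_add]
      · rw [Finset.disjoint_filter]
        rintro x - hx ⟨ab, hab, harc⟩
        have h3 := harc.slotTail_eq
        rw [← G.dual.slotTail_eq_of_mem_through (a := Slot.dart (G.rev d)) hp'.1 rfl h.tail_out hab,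
          hx.slotTail_eq] at h3
        refine (List.nodup_cons.1 hp.2).1 ?_
        rw [← hp.1.1, List.map_cons,
          ← G.dual.map_slotTail_through hp'.1 (a := Slot.dart (G.rev d)) rfl l]
        exact List.mem_map.2 ⟨ab, hab, h3.symm⟩
  have := key p u (Slot.corner k) h.isPath h.tail_in
  rw [← throughDirections_eq] at this
  convert this
  exact Iff.rfl

/-! ### Parity of closed dual walks -/

open Classical in
/-- How often, modulo two, a dart crosses from or to the left side of an extended path. -/
noncomputable def sideParity (H : EmbeddedGraph V D) (k : D) (p : List D) (l : D) (d : D) :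
    ZMod 2 :=
  (if H.LiesLeft k p l d then 1 else 0) + (if H.LiesLeft k p l (H.rev d) then 1 else 0)

/-- How often, modulo two, a walk crosses an extended path. -/
noncomputable def walkParity (H : EmbeddedGraph V D) (k : D) (p : List D) (l : D) (c : List D) :
    ZMod 2 :=
  (c.map (H.sideParity k p l)).sum

theorem walkParity_append (H : EmbeddedGraph V D) (k : D) (p : List D) (l : D) (c c' : List D) :
    H.walkParity k p l (c ++ c') = H.walkParity k p l c + H.walkParity k p l c' := by
  simp [walkParity]

open Classical in
/-- How often, modulo two, a walk uses the edge of a dart. -/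
noncomputable def edgeCount (H : EmbeddedGraph V D) (c : List D) (x : D) : ZMod 2 :=
  (c.count x : ZMod 2) + (c.count (H.rev x) : ZMod 2)

theorem edgeCount_rev (H : EmbeddedGraph V D) (c : List D) (x : D) :
    H.edgeCount c (H.rev x) = H.edgeCount c x := by
  rw [edgeCount, edgeCount, H.rev_rev, add_comm]

theorem EdgeMem.rev {H : EmbeddedGraph V D} {c : List D} {x : D} (h : H.EdgeMem x c) :
    H.EdgeMem (H.rev x) c := by
  rcases h with h | h
  · exact Or.inr (by rwa [H.rev_rev])
  · exact Or.inl h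

theorem edgeMem_rev_iff {H : EmbeddedGraph V D} {c : List D} {x : D} :
    H.EdgeMem (H.rev x) c ↔ H.EdgeMem x c :=
  ⟨fun h => by simpa [H.rev_rev] using h.rev, EdgeMem.rev⟩

theorem edgeCount_eq_zero {H : EmbeddedGraph V D} {c : List D} {x : D} (h : ¬ H.EdgeMem x c) :
    H.edgeCount c x = 0 := by
  classical
  have h1 := List.count_eq_zero_of_not_mem (fun h1 => h (Or.inl h1))
  have h2 := List.count_eq_zero_of_not_mem (fun h1 => h (Or.inr h1))
  rw [edgeCount]
  convert add_zero (0 : ZMod 2) using 2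
  · convert Nat.cast_zero
  · convert Nat.cast_zero

open Classical in
theorem sum_edgeCount_cons [Fintype D] (H : EmbeddedGraph V D) (d : D) (c : List D)
    (P : D → Prop) :
    ∑ x with P x, H.edgeCount (d :: c) x =
      (if P d then 1 else 0) + (if P (H.rev d) then 1 else 0) + ∑ x with P x, H.edgeCount c x := by
  have h : ∀ x, H.edgeCount (d :: c) x =
      ((if x = d then 1 else 0) + (if x = H.rev d then 1 else 0)) + H.edgeCount c x := by
    intro x
    have h2 : (d = H.rev x) ↔ x = H.rev d :=
      ⟨fun h => by rw [h, H.rev_rev], fun h => by rw [h, H.rev_rev]⟩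
    simp only [edgeCount, List.count_cons, beq_iff_eq, h2, eq_comm (a := d) (b := x)]
    push_cast
    ring
  simp only [h, Finset.sum_add_distrib]
  simp [Finset.sum_ite_eq']

open Classical in
theorem sum_edgeCount_liesLeft [Fintype D] (H : EmbeddedGraph V D) (k : D) (p : List D) (l : D)
    (c : List D) :
    ∑ x with H.LiesLeft k p l x, H.edgeCount c x = H.walkParity k p l c := by
  induction c with
  | nil => simp [edgeCount, walkParity]
  | cons d c ih =>
    rw [sum_edgeCount_cons, ih]
    simp [walkParity, sideParity]

-- Each step counts once at its tail, through the dart, and once at its head, through the reversed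
-- dart; at inner vertices consecutive steps cancel.
open Classical in
theorem IsWalk.sum_edgeCount_tail [Fintype D] {H : EmbeddedGraph V D} {u v : V} {c : List D}
    (h : H.IsWalk u c v) (f : V) :
    ∑ x with H.tail x = f, H.edgeCount c x = (if u = f then 1 else 0) + (if v = f then 1 else 0) := by
  induction c generalizing u with
  | nil =>
    rw [show u = v from h, CharTwo.add_self_eq_zero]
    simp [edgeCount]
  | cons d c ih =>
    rw [sum_edgeCount_cons, ih h.2, h.1, add_assoc]
    change _ + ((if H.head d = f then (1 : ZMod 2) else 0) + _) = _
    rw [← add_assoc (if H.head d = f then (1 : ZMod 2) else 0), CharTwo.add_self_eq_zero, zero_add]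

/-- On the sphere, a dual cycle that crosses an extended path from `s` to `t` an odd number of
times separates `s` from `t`. -/
theorem Planar.isSeparatingCycle [Finite V] [Finite D] {G : EmbeddedGraph V D} (hG : G.Planar)
    {u v : G.Face} {k l : D} {p : List D} (h : G.dual.IsExtendedPath u k p l v) {c : List D}
    (hc : G.dual.IsCycle c) (hodd : G.dual.walkParity k p l c = 1) :
    G.IsSeparatingCycle (G.tail k) (G.tail l) c := by
  classical
  have := Fintype.ofFinite D
  refine ⟨hc, fun hreach => ?_⟩
  obtain ⟨w, hw⟩ := hc.2.1
  -- A closed dual walk is a cocycle. Its potential is constant off `c`, hence agrees at two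
  -- vertices joined by a walk that avoids `c`, while oddness says that it differs at the two ends.
  obtain ⟨φ, hφ⟩ := hG.exists_potential (G.dual.edgeCount c) (G.dual.edgeCount_rev c)
    fun f => (hw.sum_edgeCount_tail f).trans (CharTwo.add_self_eq_zero _)
  have h1 := G.dual.sum_edgeCount_liesLeft k p l c
  rw [hodd, Finset.sum_congr rfl fun x _ => hφ x, sum_liesLeft h] at h1
  have h2 : ∀ b, Relation.ReflTransGen
      (fun a b => ∃ d, G.tail d = a ∧ G.head d = b ∧ ¬ G.EdgeMem d c) (G.tail k) b →
      φ (G.tail k) = φ b := by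
    intro b hb
    induction hb with
    | refl => rfl
    | tail _ hstep ih =>
      obtain ⟨d, rfl, rfl, hd⟩ := hstep
      have h3 := hφ d
      rw [edgeCount_eq_zero (H := G.dual) hd] at h3
      exact ih.trans (CharTwo.add_eq_zero.1 h3.symm)
  rw [h2 _ hreach, CharTwo.add_self_eq_zero] at h1
  exact zero_ne_one h1

theorem IsCycle.nodup {H : EmbeddedGraph V D} {c : List D} (h : H.IsCycle c) : c.Nodup :=
  h.2.2.1.of_map _

theorem IsCycle.perm_head {H : EmbeddedGraph V D} {c : List D} (h : H.IsCycle c) :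
    (c.map H.tail).Perm (c.map H.head) := by
  obtain ⟨u, hu⟩ := h.2.1
  have h1 : (u :: c.map H.tail).Perm (u :: c.map H.head) := by
    rw [← hu.map_tail_append]
    exact (List.perm_append_singleton _ _).symm
  exact h1.cons_inv

theorem IsCycle.nodup_head {H : EmbeddedGraph V D} {c : List D} (h : H.IsCycle c) :
    (c.map H.head).Nodup :=
  h.perm_head.nodup_iff.1 h.2.2.1

theorem IsCycle.edgeCount_eq_one {H : EmbeddedGraph V D} {c : List D} (h : H.IsCycle c) {x : D}
    (hx : H.EdgeMem x c) : H.edgeCount c x = 1 := by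
  classical
  have key : ∀ x ∈ c, H.edgeCount c x = 1 := by
    intro x hx
    have h1 := List.count_eq_one_of_mem h.nodup hx
    have h2 := List.count_eq_zero_of_not_mem (h.2.2.2 x hx)
    rw [edgeCount]
    convert add_zero (1 : ZMod 2) using 2
    · rw [← Nat.cast_one, ← h1]
    · rw [← Nat.cast_zero, ← h2]
  rcases hx with hx | hx
  · exact key x hx
  · rw [← edgeCount_rev]; exact key _ hx

/-- Agreement passes from each dart to its successor. It serves to show that a coboundary supported
on a cycle is constant on it. -/
theorem IsWalk.eq_of_chain {H : EmbeddedGraph V D} {u v : V} {c : List D} (hc : H.IsWalk u c v)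
    {α : Type*} {g : D → α} (hg : ∀ d ∈ c, ∀ d' ∈ c, H.head d = H.tail d' → g d = g d') :
    ∀ d ∈ c, ∀ d' ∈ c, g d = g d' := by
  have key : ∀ (c : List D) (u : V), H.IsWalk u c v →
      (∀ d ∈ c, ∀ d' ∈ c, H.head d = H.tail d' → g d = g d') →
      ∀ d ∈ c, ∀ x ∈ c.head?, g d = g x := by
    intro c
    induction c with
    | nil => intro _ _ _ d hd; cases hd
    | cons e c ih =>
      intro u hc hg d hd x hx
      cases hx
      rcases List.mem_cons.1 hd with rfl | hd
      · rfl
      · cases c with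
        | nil => cases hd
        | cons e' c =>
          have h1 := ih _ hc.2 (fun d hd d' hd' => hg d (List.mem_cons_of_mem _ hd) d'
            (List.mem_cons_of_mem _ hd')) d hd e' rfl
          rw [h1]
          exact (hg e List.mem_cons_self e' (by simp) hc.2.1.symm).symm
  intro d hd d' hd'
  cases c with
  | nil => cases hd
  | cons e c => exact (key _ u hc hg d hd e rfl).trans (key _ u hc hg d' hd' e rfl).symm

/-- A separating dual cycle crosses an extended path from `s` to `t` an odd number of times. -/
theorem IsSeparatingCycle.walkParity_eq_one [Finite D] {G : EmbeddedGraph V D} (hG : G.Connected)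
    {u v : G.Face} {k l : D} {p : List D} (h : G.dual.IsExtendedPath u k p l v) {c : List D}
    (hc : G.IsSeparatingCycle (G.tail k) (G.tail l) c) : G.dual.walkParity k p l c = 1 := by
  classical
  have := Fintype.ofFinite D
  obtain ⟨hcyc, hsep⟩ := hc
  set R : V → V → Prop := fun a b => ∃ d, G.tail d = a ∧ G.head d = b ∧ ¬ G.EdgeMem d c with hR
  -- The indicator of the side of `s`; the aim is that its coboundary is exactly the edge indicator
  -- of `c`.
  let φ : V → ZMod 2 := fun x => if Relation.ReflTransGen R (G.tail k) x then 1 else 0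
  have hoff : ∀ d, ¬ G.EdgeMem d c → φ (G.tail d) = φ (G.head d) := by
    intro d hd
    have h1 : Relation.ReflTransGen R (G.tail k) (G.tail d) ↔
        Relation.ReflTransGen R (G.tail k) (G.head d) :=
      ⟨fun h => h.tail ⟨d, rfl, rfl, hd⟩,
        fun h => h.tail ⟨G.rev d, rfl, G.head_rev d, fun h => hd (edgeMem_rev_iff.1 h)⟩⟩
    simp only [φ, h1]
  let g : D → ZMod 2 := fun d => φ (G.tail d) + φ (G.head d)
  have hgoff : ∀ d, ¬ G.EdgeMem d c → g d = 0 := fun d hd => by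
    simp only [g, hoff d hd, CharTwo.add_self_eq_zero]
  have hgrev : ∀ d, g (G.rev d) = g d := fun d => by
    simp only [g, head_rev]; rw [add_comm]; rfl
  -- Only two ends of edges of `c` meet at this dual vertex, `d'` and `rev d`, so the vanishing sum
  -- around the face forces their values to agree.
  have hchain : ∀ d ∈ c, ∀ d' ∈ c, G.dual.head d = G.dual.tail d' → g d = g d' := by
    intro d hd d' hd' hdd
    have hne : d' ≠ G.rev d := fun h => hcyc.2.2.2 d hd (h ▸ hd')
    have hsum := G.sum_coboundary_face φ (G.face d')
    rw [Finset.sum_eq_add_of_mem d' (G.rev d) (by simp)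
      (Finset.mem_filter.2 ⟨Finset.mem_univ _, hdd⟩) hne] at hsum
    · have := CharTwo.add_eq_zero.1 hsum
      exact (this.trans (hgrev d)).symm
    · intro x hx ⟨hx1, hx2⟩
      by_contra hx0
      have hmem : G.EdgeMem x c := by
        by_contra hmem
        exact hx0 (hgoff x hmem)
      have hxf : G.face x = G.face d' := by simpa using hx
      rcases hmem with hmem | hmem
      · exact hx1 (List.inj_on_of_nodup_map hcyc.2.2.1 hmem hd' hxf)
      · have : G.rev x = d := by
          refine List.inj_on_of_nodup_map hcyc.nodup_head hmem hd ?_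
          rw [hdd]
          exact (G.dual.head_rev x).trans hxf
        exact hx2 (by rw [← this, G.rev_rev])
  obtain ⟨w, hw⟩ := hcyc.2.1
  have hconst := hw.eq_of_chain hchain
  -- Otherwise `φ` would be constant on the connected graph, although it is 1 at `s` and 0 at `t`.
  have hone : ∃ d ∈ c, g d ≠ 0 := by
    by_contra hall
    push Not at hall
    have hconst : ∀ d, φ (G.tail d) = φ (G.head d) := by
      intro d
      by_cases hd : G.EdgeMem d c
      · rcases hd with hd | hd
        · exact CharTwo.add_eq_zero.1 (hall d hd)
        · have := hall _ hd
          rw [hgrev] at this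
          exact CharTwo.add_eq_zero.1 this
      · exact hoff d hd
    have hall2 : ∀ b, Relation.ReflTransGen (fun a b => ∃ d, G.tail d = a ∧ G.head d = b)
        (G.tail k) b → φ (G.tail k) = φ b := by
      intro b hb
      induction hb with
      | refl => rfl
      | tail _ hstep ih =>
        obtain ⟨d, rfl, rfl⟩ := hstep
        exact ih.trans (hconst d)
    have h1 := hall2 _ (hG (G.tail k) (G.tail l))
    simp [φ, hsep, Relation.ReflTransGen.refl] at h1
  obtain ⟨d₀, hd₀, hne⟩ := hone
  have hg : ∀ d, g d = G.dual.edgeCount c d := by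
    intro d
    by_cases hd : G.EdgeMem d c
    · have h1 : g d = g d₀ := by
        rcases hd with hd | hd
        · exact hconst d hd d₀ hd₀
        · rw [← hgrev]; exact hconst _ hd d₀ hd₀
      rw [hcyc.edgeCount_eq_one hd, h1]
      generalize g d₀ = y at hne
      revert y; decide
    · rw [hgoff d hd, edgeCount_eq_zero (H := G.dual) hd]
  rw [← sum_edgeCount_liesLeft, ← Finset.sum_congr rfl fun x _ => hg x, sum_liesLeft h]
  simp [φ, hsep, Relation.ReflTransGen.refl]

/-! ### Shortest paths -/

theorem IsWalk.cons_map_head_append {H : EmbeddedGraph V D} {u v : V} {p q : List D}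
    (hp : H.IsWalk u p v) : u :: (p ++ q).map H.head = p.map H.tail ++ (v :: q.map H.head) := by
  rw [List.map_append, ← List.cons_append, ← hp.map_tail_append, List.append_assoc]
  rfl

theorem IsWalk.exists_split {H : EmbeddedGraph V D} {u v w : V} {p : List D} (hp : H.IsWalk u p v)
    (hw : w ∈ u :: p.map H.head) : ∃ x y, p = x ++ y ∧ H.IsWalk u x w ∧ H.IsWalk w y v := by
  induction p generalizing u with
  | nil =>
    obtain rfl : w = u := by simpa using hw
    exact ⟨[], [], rfl, rfl, hp⟩
  | cons d p ih =>
    rcases List.mem_cons.1 hw with rfl | hw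
    · exact ⟨[], d :: p, rfl, rfl, hp⟩
    · obtain ⟨x, y, rfl, hx, hy⟩ := ih hp.2 hw
      exact ⟨d :: x, y, rfl, ⟨hp.1, hx⟩, hy⟩

theorem length_append (w : D → ℝ) (p q : List D) :
    length w (p ++ q) = length w p + length w q := by
  simp [length]

theorem length_cons (w : D → ℝ) (d : D) (p : List D) :
    length w (d :: p) = w d + length w p := by
  simp [length]

theorem length_nonneg {w : D → ℝ} (hw : ∀ d, 0 < w d) (p : List D) : 0 ≤ length w p :=
  List.sum_nonneg fun x hx => by
    obtain ⟨d, -, rfl⟩ := List.mem_map.1 hx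
    exact (hw d).le

theorem length_pos {w : D → ℝ} (hw : ∀ d, 0 < w d) {p : List D} (hp : p ≠ []) :
    0 < length w p := by
  cases p with
  | nil => exact (hp rfl).elim
  | cons d p =>
    rw [length_cons]
    linarith [hw d, length_nonneg hw p]

/-- Cutting out closed detours does not lengthen a walk; hence a shortest path is also shortest
among walks. -/
theorem IsWalk.exists_isPath {H : EmbeddedGraph V D} {w : D → ℝ} (hw : ∀ d, 0 < w d) {u v : V}
    {p : List D} (hp : H.IsWalk u p v) : ∃ q, H.IsPath u q v ∧ length w q ≤ length w p := by
  induction p generalizing u with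
  | nil => exact ⟨[], ⟨hp, by simp⟩, le_rfl⟩
  | cons d p ih =>
    obtain ⟨q, hq, hle⟩ := ih hp.2
    by_cases hu : u ∈ H.head d :: q.map H.head
    · obtain ⟨x, y, rfl, hx, hy⟩ := hq.1.exists_split hu
      refine ⟨y, ⟨hy, ?_⟩, ?_⟩
      · have := hq.2
        rw [hx.cons_map_head_append] at this
        exact (List.nodup_append.1 this).2.1
      · rw [length_append] at hle
        rw [length_cons]
        linarith [hw d, length_nonneg hw x]
    · refine ⟨d :: q, ⟨⟨hp.1, hq.1⟩, List.nodup_cons.2 ⟨hu, hq.2⟩⟩, ?_⟩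
      rw [length_cons, length_cons]
      linarith

/-- Distances from the first vertex: they change along every dart by at most its length, and along
the darts of the shortest path by exactly their length. -/
theorem IsShortestPath.exists_distance {H : EmbeddedGraph V D} {w : D → ℝ} (hw : ∀ d, 0 < w d)
    {u v : V} {p : List D} (hp : H.IsShortestPath w u p v) :
    ∃ ρ : V → ℝ, (∀ d, ρ (H.head d) ≤ ρ (H.tail d) + w d) ∧
      ∀ d ∈ p, ρ (H.head d) = ρ (H.tail d) + w d := by
  let S : V → Set ℝ := fun x => {r | ∃ q, H.IsWalk u q x ∧ length w q = r}
  have hbdd : ∀ x, BddBelow (S x) := fun x =>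
    ⟨0, by rintro _ ⟨q, -, rfl⟩; exact length_nonneg hw q⟩
  have hlip : ∀ d, sInf (S (H.head d)) ≤ sInf (S (H.tail d)) + w d := by
    intro d
    by_cases hne : (S (H.tail d)).Nonempty
    · rw [← sub_le_iff_le_add]
      refine le_csInf hne ?_
      rintro _ ⟨q, hq, rfl⟩
      rw [sub_le_iff_le_add]
      refine csInf_le (hbdd _) ⟨q ++ [d], hq.append ⟨rfl, rfl⟩, ?_⟩
      simp [length]
    -- If one end of `d` is out of reach then so is the other, and both values are the default `sInf
    -- ∅ = 0`.
    · have hne' : ¬ (S (H.head d)).Nonempty := by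
        rintro ⟨_, q, hq, rfl⟩
        exact hne ⟨_, q ++ [H.rev d], hq.append ⟨rfl, H.head_rev d⟩, rfl⟩
      rw [Set.not_nonempty_iff_eq_empty] at hne hne'
      rw [hne, hne', Real.sInf_empty]
      linarith [hw d]
  refine ⟨fun x => sInf (S x), hlip, ?_⟩
  have hend : length w p ≤ sInf (S v) := by
    refine le_csInf ⟨_, p, hp.1.1, rfl⟩ ?_
    rintro _ ⟨q, hq, rfl⟩
    obtain ⟨q', hq', hle⟩ := hq.exists_isPath hw
    exact (hp.2 q' hq').trans hle
  have hstart : sInf (S u) ≤ 0 := csInf_le (hbdd _) ⟨[], rfl, rfl⟩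
  -- The inequalities `hlip` add up along the path; since the sum is an equality, each of them is.
  have key : ∀ (p : List D) (u : V), H.IsWalk u p v →
      sInf (S v) ≤ sInf (S u) + length w p ∧
      (sInf (S u) + length w p ≤ sInf (S v) →
        ∀ d ∈ p, sInf (S (H.head d)) = sInf (S (H.tail d)) + w d) := by
    intro p
    induction p with
    | nil =>
      intro u hu
      cases hu
      exact ⟨by simp [length], fun _ d hd => by cases hd⟩
    | cons d p ih =>
      intro u hu
      obtain ⟨h1, h2⟩ := ih _ hu.2
      have h3 := hlip d
      rw [hu.1] at h3
      rw [length_cons]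
      refine ⟨by linarith, fun h4 e he => ?_⟩
      rcases List.mem_cons.1 he with rfl | he
      · rw [hu.1]; linarith
      · exact h2 (by linarith) e he
  exact (key p u hp.1.1).2 (by linarith)

theorem IsWalk.le_add_length {H : EmbeddedGraph V D} {w : D → ℝ} {ρ : V → ℝ}
    (hρ : ∀ d, ρ (H.head d) ≤ ρ (H.tail d) + w d) {u v : V} {p : List D} (hp : H.IsWalk u p v) :
    ρ v ≤ ρ u + length w p := by
  induction p generalizing u with
  | nil => cases hp; simp [length]
  | cons d p ih =>
    have h1 := ih hp.2
    have h2 := hρ d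
    rw [hp.1] at h2
    rw [length_cons]
    linarith

theorem IsWalk.eq_add_length {H : EmbeddedGraph V D} {w : D → ℝ} {ρ : V → ℝ} {u v : V}
    {p : List D} (hρ : ∀ d ∈ p, ρ (H.head d) = ρ (H.tail d) + w d) (hp : H.IsWalk u p v) :
    ρ v = ρ u + length w p := by
  induction p generalizing u with
  | nil => cases hp; simp [length]
  | cons d p ih =>
    have h1 := ih (fun d hd => hρ d (List.mem_cons_of_mem _ hd)) hp.2
    have h2 := hρ d List.mem_cons_self
    rw [hp.1] at h2
    rw [length_cons]
    linarith

/-- The vertices at distance at least `ρ x` on a shortest path come after `x`. -/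
theorem IsWalk.exists_split_of_le {H : EmbeddedGraph V D} {w : D → ℝ} (hw : ∀ d, 0 < w d)
    {ρ : V → ℝ} {u v x : V} {p : List D} (hρ : ∀ d ∈ p, ρ (H.head d) = ρ (H.tail d) + w d)
    (hp : H.IsWalk u p v) (hx : x ∈ u :: p.map H.head) :
    ∃ y z, p = y ++ z ∧ H.IsWalk u y x ∧ H.IsWalk x z v ∧
      ∀ x' ∈ u :: p.map H.head, ρ x ≤ ρ x' → x' ∈ x :: z.map H.head := by
  obtain ⟨y, z, rfl, hy, hz⟩ := hp.exists_split hx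
  refine ⟨y, z, rfl, hy, hz, fun x' hx' hle => ?_⟩
  rw [hy.cons_map_head_append, List.mem_append] at hx'
  rcases hx' with hx' | hx'
  · obtain ⟨d, hd, rfl⟩ := List.mem_map.1 hx'
    obtain ⟨y₁, y₂, rfl⟩ := List.append_of_mem hd
    obtain ⟨_, -, h1, h2⟩ := isWalk_append.1 hy
    have h3 := IsWalk.eq_add_length (w := w) (ρ := ρ) (fun e he => hρ e (by simp [he])) h2
    have h4 := hρ d (by simp)
    linarith [hw d, length_nonneg hw y₂]
  · exact hx'

/-! ### Reversal and rotation of cycles -/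

theorem mem_reverse_map_rev {H : EmbeddedGraph V D} {c : List D} {x : D} :
    x ∈ (c.map H.rev).reverse ↔ H.rev x ∈ c := by
  rw [List.mem_reverse, List.mem_map]
  constructor
  · rintro ⟨y, hy, rfl⟩; rwa [H.rev_rev]
  · intro h; exact ⟨_, h, H.rev_rev x⟩

theorem edgeMem_reverse_iff {H : EmbeddedGraph V D} {c : List D} {x : D} :
    H.EdgeMem x (c.map H.rev).reverse ↔ H.EdgeMem x c := by
  rw [EdgeMem, mem_reverse_map_rev, mem_reverse_map_rev, H.rev_rev, or_comm]
  rfl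

theorem IsWalk.reverse {H : EmbeddedGraph V D} {u v : V} {c : List D} (h : H.IsWalk u c v) :
    H.IsWalk v (c.map H.rev).reverse u := by
  induction c generalizing u with
  | nil => exact (show u = v from h).symm
  | cons d c ih =>
    rw [List.map_cons, List.reverse_cons]
    exact (ih h.2).append ⟨rfl, (H.head_rev d).trans h.1⟩

theorem map_tail_reverse (H : EmbeddedGraph V D) (c : List D) :
    (c.map H.rev).reverse.map H.tail = (c.map H.head).reverse := by
  rw [List.map_reverse, List.map_map]
  rfl

theorem length_reverse {H : EmbeddedGraph V D} {w : D → ℝ} (hrev : ∀ d, w (H.rev d) = w d)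
    (c : List D) : length w (c.map H.rev).reverse = length w c := by
  rw [length, List.map_reverse, List.sum_reverse, List.map_map]
  congr 2
  funext d
  exact hrev d

theorem sideParity_rev (H : EmbeddedGraph V D) (k : D) (p : List D) (l d : D) :
    H.sideParity k p l (H.rev d) = H.sideParity k p l d := by
  rw [sideParity, sideParity, H.rev_rev, add_comm]

theorem walkParity_reverse (H : EmbeddedGraph V D) (k : D) (p : List D) (l : D) (c : List D) :
    H.walkParity k p l (c.map H.rev).reverse = H.walkParity k p l c := by
  rw [walkParity, List.map_reverse, List.sum_reverse, List.map_map]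
  congr 2
  funext d
  exact H.sideParity_rev k p l d

theorem IsCycle.reverse {H : EmbeddedGraph V D} {c : List D} (h : H.IsCycle c) :
    H.IsCycle (c.map H.rev).reverse := by
  obtain ⟨u, hu⟩ := h.2.1
  refine ⟨by simpa using h.1, ⟨u, hu.reverse⟩, ?_, fun d hd hd' => ?_⟩
  · rw [map_tail_reverse, List.nodup_reverse]
    exact h.nodup_head
  · rw [mem_reverse_map_rev] at hd hd'
    exact h.2.2.2 _ hd hd'

theorem IsCycle.swap {H : EmbeddedGraph V D} {x y : List D} (h : H.IsCycle (x ++ y)) :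
    H.IsCycle (y ++ x) := by
  obtain ⟨hne, ⟨u, hu⟩, hnodup, hrev⟩ := h
  obtain ⟨v, hx, hy⟩ := isWalk_append.1 hu
  refine ⟨by simpa [and_comm] using hne, ⟨v, hy.append hx⟩, ?_, fun d hd hd' => ?_⟩
  · rw [List.map_append] at hnodup ⊢
    exact List.nodup_append_comm.1 hnodup
  · rw [List.mem_append, or_comm, ← List.mem_append] at hd hd'
    exact hrev d hd hd'

/-- Separation depends only on the set of edges of the cycle; this covers both rotation and
reversal. -/
theorem IsShortestSeparatingCycle.congr {G : EmbeddedGraph V D} {w : D → ℝ} {s t : V}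
    {c c' : List D} (h : G.IsShortestSeparatingCycle w s t c) (hc' : G.dual.IsCycle c')
    (hmem : ∀ d, G.EdgeMem d c' ↔ G.EdgeMem d c) (hlen : length w c' = length w c) :
    G.IsShortestSeparatingCycle w s t c' := by
  refine ⟨⟨hc', ?_⟩, fun c'' h'' => hlen ▸ h.2 c'' h''⟩
  simp only [hmem]
  exact h.1.2

theorem IsShortestSeparatingCycle.swap {G : EmbeddedGraph V D} {w : D → ℝ} {s t : V}
    {x y : List D} (h : G.IsShortestSeparatingCycle w s t (x ++ y)) :
    G.IsShortestSeparatingCycle w s t (y ++ x) :=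
  h.congr h.1.1.swap (fun d => by simp only [EdgeMem, List.mem_append]; tauto)
    (by rw [length_append, length_append, add_comm])

theorem IsShortestSeparatingCycle.reverse {G : EmbeddedGraph V D} {w : D → ℝ}
    (hrev : ∀ d, w (G.rev d) = w d) {s t : V} {c : List D}
    (h : G.IsShortestSeparatingCycle w s t c) :
    G.IsShortestSeparatingCycle w s t (c.map G.rev).reverse :=
  h.congr h.1.1.reverse (fun _ => edgeMem_reverse_iff (H := G)) (length_reverse hrev c)

/-! ### Ears -/

/-- A nonempty walk with its ends in `S` and no inner vertex in `S`. -/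
structure IsPiece (H : EmbeddedGraph V D) (S : List V) (a : V) (A : List D) (b : V) : Prop where
  walk : H.IsWalk a A b
  start_mem : a ∈ S
  end_mem : b ∈ S
  ne_nil : A ≠ []
  tail_notMem : ∀ x ∈ A.tail, H.tail x ∉ S

/-- A walk that has its ends, but no inner vertex and no edge, on the path `p` from `u`. -/
structure IsEar (H : EmbeddedGraph V D) (u : V) (p : List D) (a : V) (A : List D) (b : V) : Prop
    extends H.IsPiece (u :: p.map H.head) a A b where
  not_edgeMem : ∀ x ∈ A, ¬ H.EdgeMem x p

theorem IsWalk.exists_split_first {H : EmbeddedGraph V D} {S : List V} {u v : V} {c : List D}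
    (hc : H.IsWalk u c v) (hv : v ∈ S) :
    ∃ x y b, c = x ++ y ∧ H.IsWalk u x b ∧ H.IsWalk b y v ∧ b ∈ S ∧ ∀ d ∈ x, H.tail d ∉ S := by
  induction c generalizing u with
  | nil => exact ⟨[], [], v, rfl, hc, rfl, hv, by simp⟩
  | cons d c ih =>
    by_cases hd : H.tail d ∈ S
    · exact ⟨[], d :: c, u, rfl, rfl, hc, hc.1 ▸ hd, by simp⟩
    · obtain ⟨x, y, b, rfl, hx, hy, hb, hxS⟩ := ih hc.2
      refine ⟨d :: x, y, b, rfl, ⟨hc.1, hx⟩, hy, hb, fun e he => ?_⟩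
      rcases List.mem_cons.1 he with rfl | he
      · exact hd
      · exact hxS e he

/-- A walk decomposes into pieces, one of which inherits a given property of the walk. -/
theorem IsWalk.exists_piece {H : EmbeddedGraph V D} {S : List V} {u v : V} {c : List D}
    (hc : H.IsWalk u c v) (hu : u ∈ S) (hv : v ∈ S) {Q : List D → Prop} (hnil : ¬ Q [])
    (happ : ∀ x y, Q (x ++ y) → Q x ∨ Q y) (hQ : Q c) :
    ∃ x A y a b, c = x ++ (A ++ y) ∧ H.IsWalk u x a ∧ H.IsPiece S a A b ∧ H.IsWalk b y v ∧ Q A := by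
  induction hn : c.length using Nat.strong_induction_on generalizing u c with
  | _ n ih =>
    cases c with
    | nil => exact (hnil hQ).elim
    | cons d c =>
      -- The first dart is set aside, so that the cut is at the first return to `S` and not at the
      -- start.
      obtain ⟨x, y, b, rfl, hx, hy, hb, hxS⟩ := hc.2.exists_split_first hv
      have hpiece : H.IsPiece S u (d :: x) b := ⟨⟨hc.1, hx⟩, hu, hb, by simp, hxS⟩
      rcases happ (d :: x) y hQ with h | h
      · exact ⟨[], d :: x, y, u, b, rfl, rfl, hpiece, hy, h⟩
      · obtain ⟨x', A, y', a, b', rfl, hx', hA, hy', hQA⟩ :=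
          ih y.length (by rw [← hn]; simp) hy hb h rfl
        exact ⟨d :: x ++ x', A, y', a, b', by simp, hpiece.walk.append hx', hA, hy', hQA⟩

theorem IsWalk.tail_mem {H : EmbeddedGraph V D} {u v : V} {p : List D} (hp : H.IsWalk u p v)
    {x : D} (hx : x ∈ p) : H.tail x ∈ u :: p.map H.head := by
  rw [← hp.map_tail_append]
  exact List.mem_append_left _ (List.mem_map_of_mem hx)

theorem head_mem_of_mem (H : EmbeddedGraph V D) (u : V) {p : List D} {x : D} (hx : x ∈ p) :
    H.head x ∈ u :: p.map H.head :=
  List.mem_cons_of_mem _ (List.mem_map_of_mem hx)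

theorem IsWalk.tail_mem_of_edgeMem {H : EmbeddedGraph V D} {u v : V} {p : List D}
    (hp : H.IsWalk u p v) {x : D} (hx : H.EdgeMem x p) : H.tail x ∈ u :: p.map H.head := by
  rcases hx with hx | hx
  · exact hp.tail_mem hx
  · rw [← H.head_rev]; exact H.head_mem_of_mem u hx

theorem IsWalk.head_mem_of_edgeMem {H : EmbeddedGraph V D} {u v : V} {p : List D}
    (hp : H.IsWalk u p v) {x : D} (hx : H.EdgeMem x p) : H.head x ∈ u :: p.map H.head :=
  hp.tail_mem_of_edgeMem hx.rev

/-- A piece that is not an ear is a single edge of the path. -/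
theorem IsPiece.isEar_or {H : EmbeddedGraph V D} {u v : V} {p : List D} (hp : H.IsWalk u p v)
    {a b : V} {A : List D} (hA : H.IsPiece (u :: p.map H.head) a A b) :
    H.IsEar u p a A b ∨ ∃ x, A = [x] ∧ H.EdgeMem x p := by
  by_cases h : ∀ x ∈ A, ¬ H.EdgeMem x p
  · exact Or.inl ⟨hA, h⟩
  · push Not at h
    obtain ⟨x, hx, hxp⟩ := h
    refine Or.inr ⟨x, ?_, hxp⟩
    obtain ⟨hwalk, -, -, -, hS⟩ := hA
    cases A with
    | nil => cases hx
    | cons d A =>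
      rcases List.mem_cons.1 hx with rfl | hx
      · cases A with
        | nil => rfl
        | cons y A =>
          refine (hS y List.mem_cons_self ?_).elim
          rw [hwalk.2.1]
          exact hp.head_mem_of_edgeMem hxp
      · exact (hS x hx (hp.tail_mem_of_edgeMem hxp)).elim

/-- The head of every dart but the last is the tail of the next one, so the condition on tails in
`IsPiece` has a mirror image for heads. -/
theorem IsPiece.exists_ends {H : EmbeddedGraph V D} {S : List V} {a b : V} {A : List D}
    (hA : H.IsPiece S a A b) :
    ∃ f A' A₀ e, A = f :: A' ∧ A = A₀ ++ [e] ∧ H.tail f = a ∧ H.head e = b ∧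
      (∀ x ∈ A', H.tail x ∉ S) ∧ ∀ x ∈ A₀, H.head x ∉ S := by
  obtain ⟨hwalk, -, -, hne, hS⟩ := hA
  obtain ⟨f, A', rfl⟩ := List.exists_cons_of_ne_nil hne
  obtain h | ⟨A₀, e, h⟩ := List.eq_nil_or_concat (f :: A')
  · cases h
  rw [List.concat_eq_append] at h
  have h1 := hwalk.map_tail_append
  have h2 : (f :: A').map H.head = A₀.map H.head ++ [H.head e] := by rw [h]; simp
  rw [h2, List.map_cons, List.cons_append, hwalk.1] at h1
  obtain ⟨h3, h4⟩ := List.append_inj' (List.cons.inj h1).2 rfl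
  refine ⟨f, A', A₀, e, rfl, h, hwalk.1, (List.cons.inj h4).1.symm, hS, fun x hx => ?_⟩
  have h5 : H.head x ∈ A'.map H.tail := h3 ▸ List.mem_map_of_mem hx
  obtain ⟨y, hy, hyx⟩ := List.mem_map.1 h5
  exact hyx ▸ hS y hy

theorem IsEar.reverse {H : EmbeddedGraph V D} {u : V} {p : List D} {a b : V} {A : List D}
    (hA : H.IsEar u p a A b) : H.IsEar u p b (A.map H.rev).reverse a := by
  obtain ⟨f, A', A₀, e, -, h2, -, -, -, hS⟩ := hA.exists_ends
  refine ⟨⟨hA.walk.reverse, hA.end_mem, hA.start_mem, by simpa using hA.ne_nil, ?_⟩, ?_⟩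
  · intro x hx
    rw [h2] at hx
    simp only [List.map_append, List.map_cons, List.map_nil, List.reverse_append,
      List.reverse_cons, List.reverse_nil, List.nil_append, List.singleton_append,
      List.tail_cons] at hx
    rw [mem_reverse_map_rev] at hx
    rw [← H.head_rev]
    exact hS _ hx
  · intro x hx hxp
    exact hA.not_edgeMem _ (mem_reverse_map_rev.1 hx) hxp.rev

open Classical in
/-- The indicator function of the left side. -/
noncomputable def leftParity (H : EmbeddedGraph V D) (k : D) (p : List D) (l : D) (d : D) :
    ZMod 2 :=
  if H.LiesLeft k p l d then 1 else 0

section Parity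

variable {H : EmbeddedGraph V D} {u v : V} {k l : D} {p : List D}

theorem IsExtendedPath.leftParity_eq_zero (h : H.IsExtendedPath u k p l v) {x : D}
    (hx : H.tail x ∉ u :: p.map H.head) : H.leftParity k p l x = 0 :=
  if_neg fun hl => hx (h.tail_mem_of_liesLeft hl)

theorem IsExtendedPath.sideParity_eq_zero [Finite D] (h : H.IsExtendedPath u k p l v) {x : D}
    (hx : H.EdgeMem x p) : H.sideParity k p l x = 0 := by
  rw [sideParity, if_neg (h.not_liesLeft hx), if_neg (h.not_liesLeft hx.rev), add_zero]

theorem IsExtendedPath.walkParity_eq_zero [Finite D] (h : H.IsExtendedPath u k p l v)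
    {c : List D} (hc : ∀ x ∈ c, H.EdgeMem x p) : H.walkParity k p l c = 0 :=
  List.sum_eq_zero fun y hy => by
    obtain ⟨x, hx, rfl⟩ := List.mem_map.1 hy
    exact h.sideParity_eq_zero (hc x hx)

/-- On a cycle every head is also a tail, so no edge end is based on the path. Consequently a
separating cycle meets the path. -/
theorem IsExtendedPath.walkParity_eq_zero_of_tail (h : H.IsExtendedPath u k p l v)
    {c : List D} (hc : H.IsCycle c) (hS : ∀ x ∈ c, H.tail x ∉ u :: p.map H.head) :
    H.walkParity k p l c = 0 :=
  List.sum_eq_zero fun y hy => by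
    obtain ⟨x, hx, rfl⟩ := List.mem_map.1 hy
    have h1 : H.head x ∈ c.map H.tail := hc.perm_head.mem_iff.2 (List.mem_map_of_mem hx)
    obtain ⟨z, hz, hzx⟩ := List.mem_map.1 h1
    have h2 := h.leftParity_eq_zero (hS x hx)
    have h3 := h.leftParity_eq_zero (x := H.rev x) (fun h4 => hS z hz (hzx ▸ h4))
    exact (congrArg₂ (· + ·) h2 h3).trans (add_zero 0)

/-- Only the ends of a piece count for its parity. -/
theorem IsExtendedPath.walkParity_piece (h : H.IsExtendedPath u k p l v) {A A' A₀ : List D}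
    {e f : D} (h1 : A = f :: A') (h2 : A = A₀ ++ [e])
    (hA' : ∀ x ∈ A', H.tail x ∉ u :: p.map H.head)
    (hA₀ : ∀ x ∈ A₀, H.head x ∉ u :: p.map H.head) :
    H.walkParity k p l A = H.leftParity k p l f + H.leftParity k p l (H.rev e) := by
  have h3 : H.walkParity k p l A = (A.map (H.leftParity k p l)).sum +
      (A.map (fun d => H.leftParity k p l (H.rev d))).sum := by
    rw [← List.sum_map_add]
    rfl
  rw [h3]
  congr 1
  · rw [h1, List.map_cons, List.sum_cons, List.sum_eq_zero, add_zero]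
    intro y hy
    obtain ⟨x, hx, rfl⟩ := List.mem_map.1 hy
    exact h.leftParity_eq_zero (hA' x hx)
  · rw [h2, List.map_append, List.sum_append, List.sum_eq_zero, zero_add]
    · simp
    · intro y hy
      obtain ⟨x, hx, rfl⟩ := List.mem_map.1 hy
      exact h.leftParity_eq_zero (hA₀ x hx)

/-- At a vertex of the path, right means not left for edges off the path. Crossings thereby become
equations in `ZMod 2`. -/
theorem IsExtendedPath.sides_iff [Finite D] (h : H.IsExtendedPath u k p l v) {x y : D}
    (hx : H.tail x ∈ u :: p.map H.head) (hxp : ¬ H.EdgeMem x p)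
    (hy : H.tail y ∈ u :: p.map H.head) (hyp : ¬ H.EdgeMem y p) :
    ((H.LiesLeft k p l x ∧ H.LiesRight k p l y) ∨ (H.LiesRight k p l x ∧ H.LiesLeft k p l y)) ↔
      H.leftParity k p l x + H.leftParity k p l y = 1 := by
  have key : ∀ z, H.tail z ∈ u :: p.map H.head → ¬ H.EdgeMem z p →
      (H.LiesRight k p l z ↔ ¬ H.LiesLeft k p l z) := fun z hz hzp =>
    ⟨fun h1 h2 => h.not_liesRight h2 h1, (h.liesLeft_or_liesRight hz hzp).resolve_left⟩
  rw [key x hx hxp, key y hy hyp, leftParity, leftParity]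
  by_cases h1 : H.LiesLeft k p l x <;> by_cases h2 : H.LiesLeft k p l y <;> simp [h1, h2]

end Parity

/-! ### Cycles made of ears and parts of a path -/

theorem IsPath.rev_notMem {H : EmbeddedGraph V D} {u v : V} {p : List D} (hp : H.IsPath u p v)
    {x : D} (hx : x ∈ p) : H.rev x ∉ p := by
  induction p generalizing u with
  | nil => cases hx
  | cons d p ih =>
    obtain ⟨hwalk, hnodup⟩ := hp
    obtain ⟨hu, hnodup⟩ := List.nodup_cons.1 hnodup
    have hkey : H.rev d ∉ p := fun h => hu <| by
      rw [← hwalk.1, ← H.head_rev d]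
      exact List.mem_cons_of_mem _ (List.mem_map_of_mem h)
    intro hx'
    rcases List.mem_cons.1 hx with rfl | hx
    · rcases List.mem_cons.1 hx' with h | h
      · exact H.rev_ne _ h
      · exact hkey h
    · rcases List.mem_cons.1 hx' with h | h
      · exact hkey (by rwa [← h, H.rev_rev])
      · exact ih ⟨hwalk.2, hnodup⟩ hx h

theorem IsPath.rev_notMem_of_ears {H : EmbeddedGraph V D} {u v : V} {p : List D}
    (hp : H.IsPath u p v) {c z : List D} (hc : ∀ x ∈ c, x ∈ z ∨ x ∈ p)
    (hz : ∀ x ∈ z, ¬ H.EdgeMem x p) (hrev : ∀ x ∈ z, H.rev x ∉ z) : ∀ x ∈ c, H.rev x ∉ c := by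
  intro x hx hx'
  rcases hc x hx with h1 | h1 <;> rcases hc _ hx' with h2 | h2
  · exact hrev x h1 h2
  · exact hz x h1 (Or.inr h2)
  · exact hz _ h2 (Or.inr (by rwa [H.rev_rev]))
  · exact hp.rev_notMem h1 h2

/-- An ear together with the part of the path between its ends is a cycle. -/
theorem IsEar.isCycle {H : EmbeddedGraph V D} {u v a b : V} {x y q A : List D}
    (hp : H.IsPath u (x ++ (q ++ y)) v) (hx : H.IsWalk u x b) (hq : H.IsWalk b q a)
    (hA : H.IsEar u (x ++ (q ++ y)) a A b) (hnodup : (A.map H.tail).Nodup)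
    (hrev : ∀ d ∈ A, H.rev d ∉ A) : H.IsCycle (A ++ q) := by
  -- The vertices of the path, cut at `b` and `a`. The tails of `q` omit `a`, which is the first
  -- tail of `A`, so the tails of `A ++ q` do not repeat.
  have hS : u :: (x ++ (q ++ y)).map H.head =
      x.map H.tail ++ (q.map H.tail ++ (a :: y.map H.head)) := by
    rw [hx.cons_map_head_append, hq.cons_map_head_append]
  refine ⟨by simp [hA.ne_nil], ⟨a, hA.walk.append hq⟩, ?_, ?_⟩
  · obtain ⟨f, A', -, -, rfl, -, hf, -, hA', -⟩ := hA.exists_ends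
    have h1 := hp.2
    rw [hS] at h1 hA'
    rw [List.map_append, List.nodup_append]
    refine ⟨hnodup, ?_, ?_⟩
    · exact (List.nodup_append.1 (List.nodup_append.1 h1).2.1).1
    · intro z hz z' hz' hzz
      subst hzz
      rcases List.mem_cons.1 hz with hz | hz
      · rw [hz, hf] at hz'
        exact (List.nodup_append.1 (List.nodup_append.1 h1).2.1).2.2 a hz' a
          List.mem_cons_self rfl
      · obtain ⟨d, hd, rfl⟩ := List.mem_map.1 hz
        exact hA' d hd (by simp only [List.mem_append]; tauto)
  · exact hp.rev_notMem_of_ears (z := A)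
      (fun d hd => by simp only [List.mem_append] at hd ⊢; tauto) hA.not_edgeMem hrev

/-- Two disjoint ears, joined by two parts of the path, form a cycle. -/
theorem IsEar.isCycle_of_isEar {H : EmbeddedGraph V D} {u v a a' b b' : V}
    {x y q₁ q₂ m A B : List D}
    (hp : H.IsPath u (x ++ (q₁ ++ (m ++ (q₂ ++ y)))) v) (hx : H.IsWalk u x a')
    (hq₁ : H.IsWalk a' q₁ b) (hm : H.IsWalk b m b') (hq₂ : H.IsWalk b' q₂ a) (hne : m ≠ [])
    (hA : H.IsEar u (x ++ (q₁ ++ (m ++ (q₂ ++ y)))) a A a')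
    (hB : H.IsEar u (x ++ (q₁ ++ (m ++ (q₂ ++ y)))) b B b')
    (hnodup : ((A ++ B).map H.tail).Nodup)
    (hrev : ∀ d ∈ A ++ B, H.rev d ∉ A ++ B) : H.IsCycle (A ++ (q₁ ++ (B ++ q₂))) := by
  have hS : u :: (x ++ (q₁ ++ (m ++ (q₂ ++ y)))).map H.head =
      x.map H.tail ++ (q₁.map H.tail ++ (m.map H.tail ++ (q₂.map H.tail ++
        (a :: y.map H.head)))) := by
    rw [hx.cons_map_head_append, hq₁.cons_map_head_append, hm.cons_map_head_append,
      hq₂.cons_map_head_append]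
  refine ⟨by simp [hA.ne_nil], ⟨a, hA.walk.append (hq₁.append (hB.walk.append hq₂))⟩, ?_, ?_⟩
  · obtain ⟨f, A', -, -, rfl, -, rfl, -, hA', -⟩ := hA.exists_ends
    obtain ⟨g, B', -, -, rfl, -, rfl, -, hB', -⟩ := hB.exists_ends
    -- The first tail of `m` is `b`, the start of `B`; this keeps `b` distinct from `a` and from the
    -- tails of `q₂`.
    obtain ⟨d, m, rfl⟩ := List.exists_cons_of_ne_nil hne
    have h1 := hp.2
    rw [hS] at h1
    replace hA' : ∀ z ∈ A'.map H.tail, z ∉ x.map H.tail ++ (q₁.map H.tail ++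
        ((d :: m).map H.tail ++ (q₂.map H.tail ++ (H.tail f :: y.map H.head)))) := by
      intro z hz
      obtain ⟨d, hd, rfl⟩ := List.mem_map.1 hz
      exact hS ▸ hA' d hd
    replace hB' : ∀ z ∈ B'.map H.tail, z ∉ x.map H.tail ++ (q₁.map H.tail ++
        ((d :: m).map H.tail ++ (q₂.map H.tail ++ (H.tail f :: y.map H.head)))) := by
      intro z hz
      obtain ⟨d, hd, rfl⟩ := List.mem_map.1 hz
      exact hS ▸ hB' d hd
    simp only [List.map_append, List.map_cons, hm.1] at h1 hA' hB' hnodup ⊢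
    generalize A'.map H.tail = A' at *
    generalize B'.map H.tail = B' at *
    generalize q₁.map H.tail = q₁' at *
    generalize q₂.map H.tail = q₂' at *
    generalize x.map H.tail = x' at *
    generalize m.map H.tail = m' at *
    generalize y.map H.head = y' at *
    clear * - h1 hA' hB' hnodup
    simp only [List.mem_append, List.mem_cons, List.nodup_append, List.nodup_cons,
      List.cons_append] at *
    grind
  · exact hp.rev_notMem_of_ears (z := A ++ B)
      (fun d hd => by simp only [List.mem_append] at hd ⊢; tauto)
      (fun d hd => (List.mem_append.1 hd).elim (hA.not_edgeMem d) (hB.not_edgeMem d)) hrev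

/-! ### Counting crossings -/

/-- Without repetitions, only a trivial rotation keeps `e` in front. -/
theorem eq_of_cons_isRotated {e : D} {c₁ c₂ : List D} (h : (e :: c₁) ~r (e :: c₂))
    (hnodup : (e :: c₁).Nodup) : c₁ = c₂ := by
  obtain ⟨n, hn⟩ := h
  rw [List.rotate_eq_drop_append_take_mod] at hn
  have h1 := List.take_append_drop (n % (e :: c₁).length) (e :: c₁)
  generalize List.take (n % (e :: c₁).length) (e :: c₁) = x at h1 hn
  generalize List.drop (n % (e :: c₁).length) (e :: c₁) = y at h1 hn
  cases x with
  | nil =>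
    rw [List.append_nil] at hn
    rw [List.nil_append] at h1
    exact (List.cons.inj (h1.symm.trans hn)).2
  | cons a x =>
    cases y with
    | nil =>
      rw [List.append_nil] at h1
      rw [List.nil_append] at hn
      exact (List.cons.inj (h1.symm.trans hn)).2
    | cons b y =>
      have h2 := (List.cons.inj h1).1
      have h3 := (List.cons.inj hn).1
      subst h2 h3
      rw [← h1] at hnodup
      simp at hnodup

/-- Both prefixes are the longest one on which `Q` holds. With `Q` meaning "edge of the path", this
determines the run and the last edge of a crossing. -/
theorem eq_of_append_cons_eq {α : Type*} {Q : α → Prop} {x x' y y' : List α} {f f' : α}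
    (h : x ++ f :: y = x' ++ f' :: y') (hx : ∀ d ∈ x, Q d) (hx' : ∀ d ∈ x', Q d) (hf : ¬ Q f)
    (hf' : ¬ Q f') : x = x' ∧ f = f' := by
  induction x generalizing x' with
  | nil =>
    cases x' with
    | nil => exact ⟨rfl, (List.cons.inj h).1⟩
    | cons a x' => exact (hf ((List.cons.inj h).1 ▸ hx' a List.mem_cons_self)).elim
  | cons a x ih =>
    cases x' with
    | nil => exact (hf' ((List.cons.inj h).1 ▸ hx a List.mem_cons_self)).elim
    | cons b x' =>
      obtain ⟨rfl, h2⟩ := List.cons.inj h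
      obtain ⟨rfl, h3⟩ := ih h2 (fun d hd => hx d (List.mem_cons_of_mem _ hd))
        (fun d hd => hx' d (List.mem_cons_of_mem _ hd))
      exact ⟨rfl, h3⟩

section Crossings

variable {H : EmbeddedGraph V D} {u v : V} {k l : D} {p : List D}

theorem edgeMem_of_mem_run {run : List D}
    (h : run <:+: p ∨ run <:+: (p.map H.rev).reverse) {x : D} (hx : x ∈ run) : H.EdgeMem x p := by
  rcases h with h | h
  · exact Or.inl (h.subset hx)
  · exact Or.inr (mem_reverse_map_rev.1 (h.subset hx))

theorem IsExtendedPath.not_edgeMem_of_side [Finite D] (h : H.IsExtendedPath u k p l v) {x : D}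
    (hx : H.LiesLeft k p l x ∨ H.LiesRight k p l x) :
    ¬ H.EdgeMem x p ∧ H.tail x ∈ u :: p.map H.head := by
  rcases hx with hx | hx
  · exact ⟨fun hxp => h.not_liesLeft hxp hx, h.tail_mem_of_liesLeft hx⟩
  · exact ⟨fun hxp => h.not_liesRight_of_edgeMem hxp hx, h.tail_mem_of_liesRight hx⟩

/-- The first edge of a crossing does not belong to the path, but leads to it. -/
theorem IsExtendedPath.exists_first_of_isCrossing [Finite D] (h : H.IsExtendedPath u k p l v)
    {c q : List D} (hq : H.IsCrossing k p l c q) :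
    ∃ e q', q = e :: q' ∧ e ∈ c ∧ ¬ H.EdgeMem e p ∧ H.head e ∈ u :: p.map H.head := by
  obtain ⟨e, run, f, rfl, ⟨c₁, c₂, h1, h2⟩, -, hside⟩ := hq
  have h3 : H.LiesLeft k p l (H.rev e) ∨ H.LiesRight k p l (H.rev e) :=
    hside.imp And.left And.left
  obtain ⟨h4, h5⟩ := h.not_edgeMem_of_side h3
  exact ⟨e, _, rfl, h1.mem_iff.1 List.mem_cons_self, fun h6 => h4 h6.rev, h5⟩

/-- A crossing is determined by its first edge. -/
theorem IsExtendedPath.isCrossing_cons_iff [Finite D] (h : H.IsExtendedPath u k p l v)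
    {c c₁ c₂ q : List D} {e f : D} (hc : c.Nodup) (h1 : (e :: c₁) ~r c)
    (h2 : c₁ ++ [e] = q ++ f :: c₂) (hq : q <:+: p) (hep : ¬ H.EdgeMem e p)
    (hfp : ¬ H.EdgeMem f p) (he : H.head e ∈ u :: p.map H.head)
    (hf : H.tail f ∈ u :: p.map H.head) (q' : List D) :
    H.IsCrossing k p l c (e :: q') ↔
      q' = q ++ [f] ∧ H.leftParity k p l (H.rev e) + H.leftParity k p l f = 1 := by
  have hiff := h.sides_iff (x := H.rev e) (y := f) he (fun h3 => hep (edgeMem_rev_iff.1 h3)) hf hfp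
  constructor
  · rintro ⟨e', run, f', heq, ⟨c₁', c₂', h1', h2'⟩, hrun, hside⟩
    obtain ⟨rfl, rfl⟩ := List.cons.inj heq
    obtain rfl := eq_of_cons_isRotated (h1.trans h1'.symm) (h1.nodup_iff.2 hc)
    have hf'p : ¬ H.EdgeMem f' p := (h.not_edgeMem_of_side
      (hside.elim (fun h => Or.inr h.2) (fun h => Or.inl h.2))).1
    obtain ⟨rfl, rfl⟩ := eq_of_append_cons_eq (Q := fun x => H.EdgeMem x p) (h2.symm.trans h2')
      (fun x hx => Or.inl (hq.subset hx)) (fun x hx => edgeMem_of_mem_run hrun hx) hfp hf'p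
    exact ⟨rfl, hiff.1 hside⟩
  · rintro ⟨rfl, h3⟩
    exact ⟨e, q, f, rfl, ⟨c₁, c₂, h1, h2⟩, Or.inl hq, hiff.2 h3⟩

theorem numCrossings_eq_one {c q₀ : List D} (hq : ∀ q, H.IsCrossing k p l c q ↔ q = q₀) :
    H.numCrossings k p l c = 1 := by
  rw [numCrossings, Set.ncard_eq_one]
  exact ⟨q₀, Set.ext hq⟩

theorem isRotated_cons_append (e : D) (x y : List D) : (e :: (y ++ x)) ~r (x ++ (e :: y)) :=
  List.isRotated_append (l := e :: y) (l' := x)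

theorem eq_last_of_mem_ear {S : List V} {A A₀ : List D} {e e' : D} (hA : A = A₀ ++ [e])
    (hA₀ : ∀ x ∈ A₀, H.head x ∉ S) (he' : e' ∈ A) (hS : H.head e' ∈ S) : e' = e := by
  rw [hA, List.mem_append, List.mem_singleton] at he'
  exact he'.resolve_left fun h => hA₀ _ h hS

/-- An odd ear together with a part of the path crosses the path once. -/
theorem IsEar.numCrossings_eq_one [Finite D] (h : H.IsExtendedPath u k p l v) {a b : V}
    {A q : List D} (hA : H.IsEar u p a A b) (hodd : H.walkParity k p l A = 1) (hq : q <:+: p)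
    (hc : (A ++ q).Nodup) : H.numCrossings k p l (A ++ q) = 1 := by
  obtain ⟨f, A', A₀, e, h1, h2, hf, he, hA', hA₀⟩ := hA.exists_ends
  rw [h.walkParity_piece h1 h2 hA' hA₀] at hodd
  have hfA : f ∈ A := by rw [h1]; exact List.mem_cons_self
  have heA : e ∈ A := by rw [h2]; simp
  -- The only candidate leads from the last dart of `A` through `q` to its first dart; oddness of
  -- `A` puts these on different sides.
  have key := h.isCrossing_cons_iff (c₁ := q ++ A₀) (c₂ := A') (q := q) (e := e) (f := f) hc
    (by rw [h2, List.append_assoc]; exact isRotated_cons_append _ _ _)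
    (by rw [List.append_assoc, ← h2, h1]) hq
    (hA.not_edgeMem e heA) (hA.not_edgeMem f hfA) (he ▸ hA.end_mem) (hf ▸ hA.start_mem)
  refine EmbeddedGraph.numCrossings_eq_one (q₀ := e :: (q ++ [f])) fun q' => ?_
  constructor
  · intro hq'
    obtain ⟨e', q', rfl, he'c, he'p, he'S⟩ := h.exists_first_of_isCrossing hq'
    have hee : e' = e := by
      rcases List.mem_append.1 he'c with h3 | h3
      · exact eq_last_of_mem_ear h2 hA₀ h3 he'S
      · exact (he'p (Or.inl (hq.subset h3))).elim
    subst hee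
    rw [((key q').1 hq').1]
  · rintro rfl
    exact (key _).2 ⟨rfl, by rwa [add_comm]⟩

/-- An odd and an even ear, joined by two parts of the path, cross the path once. -/
theorem IsEar.numCrossings_eq_one_of_isEar [Finite D] (h : H.IsExtendedPath u k p l v)
    {a a' b b' : V} {A B q₁ q₂ : List D} (hA : H.IsEar u p a A a') (hB : H.IsEar u p b B b')
    (hodd : H.walkParity k p l A = 1) (heven : H.walkParity k p l B = 0) (hq₁ : q₁ <:+: p)
    (hq₂ : q₂ <:+: p) (hc : (A ++ (q₁ ++ (B ++ q₂))).Nodup) :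
    H.numCrossings k p l (A ++ (q₁ ++ (B ++ q₂))) = 1 := by
  obtain ⟨f, A', A₀, e, h1, h2, hf, he, hA', hA₀⟩ := hA.exists_ends
  obtain ⟨g, B', B₀, d, h3, h4, hg, hd, hB', hB₀⟩ := hB.exists_ends
  rw [h.walkParity_piece h1 h2 hA' hA₀] at hodd
  rw [h.walkParity_piece h3 h4 hB' hB₀] at heven
  have hfA : f ∈ A := by rw [h1]; exact List.mem_cons_self
  have heA : e ∈ A := by rw [h2]; simp
  have hgB : g ∈ B := by rw [h3]; exact List.mem_cons_self
  have hdB : d ∈ B := by rw [h4]; simp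
  have key₁ := h.isCrossing_cons_iff (c₁ := (q₁ ++ (B ++ q₂)) ++ A₀) (c₂ := B' ++ (q₂ ++ A))
    (q := q₁) (e := e) (f := g) hc
    (by conv_rhs => rw [h2, List.append_assoc]
        exact isRotated_cons_append _ _ _)
    (by rw [List.append_assoc, ← h2, h3]; simp) hq₁
    (hA.not_edgeMem e heA) (hB.not_edgeMem g hgB) (he ▸ hA.end_mem) (hg ▸ hB.start_mem)
  have key₂ := h.isCrossing_cons_iff (c₁ := q₂ ++ (A ++ q₁ ++ B₀)) (c₂ := A' ++ (q₁ ++ B))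
    (q := q₂) (e := d) (f := f) hc
    (by have := isRotated_cons_append d (A ++ q₁ ++ B₀) q₂
        conv_rhs => rw [h4]
        simpa using this)
    (by rw [h1, h4]; simp) hq₂
    (hB.not_edgeMem d hdB) (hA.not_edgeMem f hfA) (hd ▸ hB.end_mem) (hf ▸ hA.start_mem)
  have hfirst : ∀ q, H.IsCrossing k p l (A ++ (q₁ ++ (B ++ q₂))) q →
      (∃ q', q = e :: q') ∨ ∃ q', q = d :: q' := by
    intro q hq
    obtain ⟨e', q', rfl, he'c, he'p, he'S⟩ := h.exists_first_of_isCrossing hq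
    simp only [List.mem_append] at he'c
    rcases he'c with h5 | h5 | h5 | h5
    · exact Or.inl ⟨q', by rw [eq_last_of_mem_ear h2 hA₀ h5 he'S]⟩
    · exact (he'p (Or.inl (hq₁.subset h5))).elim
    · exact Or.inr ⟨q', by rw [eq_last_of_mem_ear h4 hB₀ h5 he'S]⟩
    · exact (he'p (Or.inl (hq₂.subset h5))).elim
  -- There are two candidates, one through `q₁` and one through `q₂`. The four parities add up to 1,
  -- so exactly one candidate is a crossing.
  by_cases hcase : H.leftParity k p l (H.rev e) + H.leftParity k p l g = 1
  · have hno : ¬ H.leftParity k p l (H.rev d) + H.leftParity k p l f = 1 := by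
      revert hodd heven hcase
      generalize H.leftParity k p l (H.rev e) = x₁
      generalize H.leftParity k p l (H.rev d) = x₂
      generalize H.leftParity k p l f = x₃
      generalize H.leftParity k p l g = x₄
      revert x₁ x₂ x₃ x₄
      decide
    refine EmbeddedGraph.numCrossings_eq_one (q₀ := e :: (q₁ ++ [g])) fun q => ⟨fun hq => ?_, ?_⟩
    · rcases hfirst q hq with ⟨q', rfl⟩ | ⟨q', rfl⟩
      · rw [((key₁ q').1 hq).1]
      · exact (hno ((key₂ q').1 hq).2).elim
    · rintro rfl
      exact (key₁ _).2 ⟨rfl, hcase⟩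
  · have hyes : H.leftParity k p l (H.rev d) + H.leftParity k p l f = 1 := by
      revert hodd heven hcase
      generalize H.leftParity k p l (H.rev e) = x₁
      generalize H.leftParity k p l (H.rev d) = x₂
      generalize H.leftParity k p l f = x₃
      generalize H.leftParity k p l g = x₄
      revert x₁ x₂ x₃ x₄
      decide
    refine EmbeddedGraph.numCrossings_eq_one (q₀ := d :: (q₂ ++ [f])) fun q => ⟨fun hq => ?_, ?_⟩
    · rcases hfirst q hq with ⟨q', rfl⟩ | ⟨q', rfl⟩
      · exact (hcase ((key₁ q').1 hq).2).elim
      · rw [((key₂ q').1 hq).1]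
    · rintro rfl
      exact (key₂ _).2 ⟨rfl, hyes⟩

end Crossings

/-! ### Rerouting along the shortest path -/

theorem zmod_two_add_eq_one {x y : ZMod 2} (h : x + y = 1) : x = 1 ∨ y = 1 := by
  revert x y
  decide

section Rerouting

variable [Finite V] [Finite D] {G : EmbeddedGraph V D} {cap : D → ℝ} {u v a b : G.Face} {k l : D}
  {p : List D} {ρ : G.Face → ℝ}

/-- The main case: a shortest separating cycle that consists of an odd ear and a walk `R`, where
the ear goes backwards along the path. -/
theorem Planar.exists_single_crossing_of_isEar (hG : G.Planar)
    (hrev : ∀ d, cap (G.rev d) = cap d) (hpos : ∀ d, 0 < cap d)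
    (h : G.dual.IsExtendedPath u k p l v)
    (hρ : ∀ d, ρ (G.dual.head d) ≤ ρ (G.dual.tail d) + cap d)
    (hρp : ∀ d ∈ p, ρ (G.dual.head d) = ρ (G.dual.tail d) + cap d) {A R : List D}
    (hc : G.IsShortestSeparatingCycle cap (G.tail k) (G.tail l) (A ++ R))
    (hA : G.dual.IsEar u p a A b) (hodd : G.dual.walkParity k p l A = 1)
    (hR : G.dual.IsWalk b R a) (hab : ρ b ≤ ρ a) {d : D} (hd : d ∈ A ++ R) :
    ∃ c', G.IsShortestSeparatingCycle cap (G.tail k) (G.tail l) c' ∧ d ∈ c' ∧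
      G.dual.numCrossings k p l c' = 1 := by
  have hcyc := hc.1.1
  have hcodd := hc.1.walkParity_eq_one hG.1 h
  -- a cycle that is odd and not longer is a shortest separating cycle
  have hshort : ∀ c', G.dual.IsCycle c' → G.dual.walkParity k p l c' = 1 →
      length cap c' ≤ length cap (A ++ R) →
      G.IsShortestSeparatingCycle cap (G.tail k) (G.tail l) c' := fun c' h1 h2 h3 =>
    ⟨hG.isSeparatingCycle h h1 h2, fun c'' h'' => h3.trans (hc.2 c'' h'')⟩
  have hlower : ∀ c', G.dual.IsCycle c' → G.dual.walkParity k p l c' = 1 →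
      length cap (A ++ R) ≤ length cap c' := fun c' h1 h2 =>
    hc.2 c' (hG.isSeparatingCycle h h1 h2)
  have hpw := h.isPath.1
  -- close the ear `A` with the path
  obtain ⟨x, z, rfl, hx, hz, hxz⟩ := hpw.exists_split_of_le hpos hρp hA.end_mem
  obtain ⟨q, y, rfl, hq, hy⟩ := hz.exists_split (hxz a hA.start_mem hab)
  have hq_inf : q <:+: x ++ (q ++ y) := ⟨x, y, by simp⟩
  have hparity : ∀ c, c <:+: x ++ (q ++ y) → G.dual.walkParity k (x ++ (q ++ y)) l c = 0 :=
    fun c hc => h.walkParity_eq_zero fun e he => Or.inl (hc.subset he)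
  have hAnodup : (A.map G.dual.tail).Nodup := by
    have := hcyc.2.2.1
    rw [List.map_append] at this
    exact (List.nodup_append.1 this).1
  have hArev : ∀ e ∈ A, G.dual.rev e ∉ A := fun e he he' =>
    hcyc.2.2.2 e (List.mem_append_left _ he) (List.mem_append_left _ he')
  have hAq := hA.isCycle h.isPath hx hq hAnodup hArev
  have hAqodd : G.dual.walkParity k (x ++ (q ++ y)) l (A ++ q) = 1 := by
    rw [walkParity_append, hodd, hparity q hq_inf, add_zero]
  have hqlen := hq.eq_add_length (w := cap) (ρ := ρ) (fun e he => hρp e (hq_inf.subset he))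
  have hRlen := hR.le_add_length hρ
  -- Minimality yields |R| ≤ |q| = ρ a - ρ b, and `hRlen` is the converse bound: R is tight. The
  -- later `linarith` calls rest on this.
  have hle := hlower _ hAq hAqodd
  rw [length_append, length_append] at hle
  have hAqshort := hshort _ hAq hAqodd (by rw [length_append, length_append]; linarith)
  have hAqnum := hA.numCrossings_eq_one h hodd hq_inf hAq.nodup
  rcases List.mem_append.1 hd with hdA | hdR
  · exact ⟨_, hAqshort, List.mem_append_left _ hdA, hAqnum⟩
  -- the piece of `R` that contains `d`
  obtain ⟨R₁, B, R₂, b₁, b₂, rfl, hR₁, hB, hR₂, hdB⟩ := hR.exists_piece (S := _)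
    (Q := fun c => d ∈ c) hA.end_mem hA.start_mem List.not_mem_nil
    (fun _ _ => List.mem_append.1) hdR
  have hR₁len := hR₁.le_add_length hρ
  have hR₂len := hR₂.le_add_length hρ
  have hBlen := hB.walk.le_add_length hρ
  have hR₁nonneg := length_nonneg hpos R₁
  have hR₂nonneg := length_nonneg hpos R₂
  have hBpos := length_pos hpos hB.ne_nil
  simp only [length_append] at hle hRlen hlower hshort
  rcases hB.isEar_or hpw with hBear | ⟨e, rfl, hep⟩
  · -- `B` is an ear
    -- By tightness ρ b₁ = ρ b + |R₁| and ρ b₂ = ρ b₁ + |B|, which fixes the order b, b₁, b₂, a on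
    -- the path.
    have hzS := hxz b₁ hB.start_mem (by linarith)
    have hzS₂ := hxz b₂ hB.end_mem (by linarith)
    have hzSa := hxz a hA.start_mem hab
    clear hxz
    obtain ⟨q₁, z₁, hz₁, hq₁, hz₁w, hsplit₁⟩ := hz.exists_split_of_le hpos
      (fun e he => hρp e (List.mem_append_right _ he)) hzS
    have hz₁mem : ∀ e ∈ z₁, e ∈ x ++ (q ++ y) := fun e he =>
      List.mem_append_right _ (hz₁ ▸ List.mem_append_right _ he)
    obtain ⟨m, z₂, rfl, hm, hz₂w, hsplit₂⟩ := hz₁w.exists_split_of_le hpos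
      (fun e he => hρp e (hz₁mem e he)) (hsplit₁ b₂ hzS₂ (by linarith))
    obtain ⟨q₂, y', rfl, hq₂, -⟩ := hz₂w.exists_split
      (hsplit₂ a (hsplit₁ a hzSa (by linarith)) (by linarith))
    clear hsplit₁ hsplit₂ hz₂w hz₁w hzS hzS₂ hzSa hAqnum hAqshort hAqodd hAq hz₁mem
    rw [hz₁] at h hA hBear hodd hcodd hparity hpw hρp hlower hshort ⊢
    have hm_inf : m <:+: x ++ (q₁ ++ (m ++ (q₂ ++ y'))) := ⟨x ++ q₁, q₂ ++ y', by simp⟩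
    have hq₁_inf : q₁ <:+: x ++ (q₁ ++ (m ++ (q₂ ++ y'))) := ⟨x, m ++ (q₂ ++ y'), by simp⟩
    have hq₂_inf : q₂ <:+: x ++ (q₁ ++ (m ++ (q₂ ++ y'))) := ⟨x ++ q₁ ++ m, y', by simp⟩
    have hmlen := hm.eq_add_length (w := cap) (ρ := ρ) (fun e he => hρp e (hm_inf.subset he))
    have hq₁len := hq₁.eq_add_length (w := cap) (ρ := ρ) (fun e he => hρp e (hq₁_inf.subset he))
    have hq₂len := hq₂.eq_add_length (w := cap) (ρ := ρ) (fun e he => hρp e (hq₂_inf.subset he))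
    have hmne : m ≠ [] := by
      rintro rfl
      cases hm
      linarith
    by_cases hBodd : G.dual.walkParity k (x ++ (q₁ ++ (m ++ (q₂ ++ y')))) l B = 1
    · -- two odd ears: then the cycle consists of them
      exfalso
      have hBsub : B.Sublist (A ++ (R₁ ++ (B ++ R₂))) :=
        ((List.sublist_append_left B R₂).trans (List.sublist_append_right R₁ _)).trans
          (List.sublist_append_right A _)
      -- `B` and `m` both run from b₁ to b₂, so `B` is reversed to close up.
      have hBcyc : G.dual.IsCycle ((B.map G.dual.rev).reverse ++ m) := by
        have hpath := h.isPath
        have hBrev := hBear.reverse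
        rw [← List.append_assoc x q₁] at hpath hBrev
        refine hBrev.isCycle hpath (hx.append hq₁) hm ?_ fun e he he' => ?_
        · rw [map_tail_reverse, List.nodup_reverse]
          exact hcyc.nodup_head.sublist (hBsub.map _)
        · rw [mem_reverse_map_rev] at he he'
          exact hcyc.2.2.2 _ (hBsub.subset he) (hBsub.subset he')
      have hBle := hlower _ hBcyc (by
        rw [walkParity_append, walkParity_reverse, hBodd, hparity m hm_inf, add_zero])
      rw [length_append, length_reverse (H := G.dual) hrev] at hBle
      -- This gives |A| ≥ ρ a - ρ b = |R|, while minimality against the cycle of `B` and `m` gives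
      -- |A| + |R| ≤ 2|B|; so R₁ and R₂ have length zero.
      have hAlen := hA.walk.reverse.le_add_length hρ
      rw [length_reverse (H := G.dual) hrev] at hAlen
      have hR₁nil : R₁ = [] := by
        by_contra hne
        linarith [length_pos hpos hne]
      have hR₂nil : R₂ = [] := by
        by_contra hne
        linarith [length_pos hpos hne]
      subst hR₁nil hR₂nil
      rw [List.nil_append, List.append_nil, walkParity_append, hodd, hBodd] at hcodd
      exact absurd hcodd (by decide)
    · have hBeven : G.dual.walkParity k (x ++ (q₁ ++ (m ++ (q₂ ++ y')))) l B = 0 := by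
        generalize G.dual.walkParity k (x ++ (q₁ ++ (m ++ (q₂ ++ y')))) l B = s at hBodd
        revert s
        decide
      have hcyc' : G.dual.IsCycle (A ++ (q₁ ++ (B ++ q₂))) := by
        refine hA.isCycle_of_isEar h.isPath hx hq₁ hm hq₂ hmne hBear ?_ ?_
        · refine hcyc.2.2.1.sublist (List.Sublist.map _ ?_)
          exact (List.Sublist.refl A).append
            (((List.sublist_append_left B R₂)).trans (List.sublist_append_right R₁ _))
        · intro e he he'
          refine hcyc.2.2.2 e ?_ ?_
          · simp only [List.mem_append] at he ⊢; tauto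
          · simp only [List.mem_append] at he' ⊢; tauto
      refine ⟨_, hshort _ hcyc' ?_ ?_, ?_, hA.numCrossings_eq_one_of_isEar h hBear hodd hBeven
        hq₁_inf hq₂_inf hcyc'.nodup⟩
      · simp only [walkParity_append, hodd, hBeven, hparity _ hq₁_inf, hparity _ hq₂_inf, add_zero]
      · simp only [length_append]
        linarith
      · simp [hdB]
  · -- `B` is an edge of the path
    obtain rfl : d = e := by simpa using hdB
    refine ⟨_, hAqshort, List.mem_append_right _ ?_, hAqnum⟩
    have hw := hB.walk
    obtain ⟨hw1, hw2⟩ := hw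
    have hw2 : G.dual.head d = b₂ := hw2
    have hlen1 : length cap [d] = cap d := by simp [length]
    have hdp : d ∈ x ++ (q ++ y) := by
      rcases hep with hdp | hdp
      · exact hdp
      -- If `d` ran backwards on the path, ρ would decrease along it, against tightness.
      · have h1 := hρp _ hdp
        rw [head_rev] at h1
        have h2 : G.dual.tail (G.dual.rev d) = G.dual.head d := rfl
        rw [h2, hw1, hw2] at h1
        linarith [hpos d, hpos (G.dual.rev d)]
    have hdlen := hρp d hdp
    rw [hw1, hw2] at hdlen
    -- An edge before b would give ρ b₂ ≤ ρ b, and one after a would give ρ a ≤ ρ b₁; tightness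
    -- excludes both.
    rcases List.mem_append.1 hdp with h1 | h1
    · exfalso
      obtain ⟨x₁, x₂, rfl⟩ := List.append_of_mem h1
      obtain ⟨_, -, -, h3⟩ := isWalk_append.1 hx
      have h4 := h3.eq_add_length (w := cap) (ρ := ρ) (fun e he => hρp e (by simp [he]))
      rw [hw2] at h4
      linarith [length_nonneg hpos x₂, hpos d]
    rcases List.mem_append.1 h1 with h1 | h1
    · exact h1
    · exfalso
      obtain ⟨y₁, y₂, rfl⟩ := List.append_of_mem h1
      obtain ⟨_, h2, h3, -⟩ := isWalk_append.1 hy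
      have h4 := h2.eq_add_length (w := cap) (ρ := ρ) (fun e he => hρp e (by simp [he]))
      rw [← h3, hw1] at h4
      linarith [length_nonneg hpos y₁, hpos d]

end Rerouting

end EmbeddedGraph

/-! ### Choice and orientation of an odd ear -/

theorem mainTheorem4 {V D : Type*} [Finite V] [Finite D]
    (G : EmbeddedGraph V D) (hG : G.Planar)
    (cap : D → ℝ) (hcap_rev : ∀ d, cap (G.rev d) = cap d) (hcap_pos : ∀ d, 0 < cap d)
    (s t : V) (hst : s ≠ t)
    (ks kt : D) (hks : G.tail ks = s) (hkt : G.tail kt = t)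
    (π : List D) (hπ : G.dual.IsShortestPath cap (G.face ks) π (G.face kt))
    (c : List D) (hc : G.IsShortestSeparatingCycle cap s t c)
    (e : D) (he : G.EdgeMem e c) :
    ∃ c' : List D, G.IsShortestSeparatingCycle cap s t c' ∧ G.EdgeMem e c' ∧
      G.dual.numCrossings ks π kt c' = 1 := by
  subst hks hkt
  -- `s ≠ t` makes the two corners distinct, which matters if π is trivial and both dummy edges meet
  -- the same face.
  have h : G.dual.IsExtendedPath (G.face ks) ks π kt (G.face kt) :=
    ⟨hπ.1, rfl, rfl, fun h => hst (by rw [h])⟩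
  obtain ⟨ρ, hρ, hρp⟩ := hπ.exists_distance hcap_pos
  -- rotate the cycle so that it starts on the path
  obtain ⟨d₀, hd₀, hd₀S⟩ : ∃ d ∈ c, G.dual.tail d ∈ G.face ks :: π.map G.dual.head := by
    by_contra hno
    push Not at hno
    have h1 := hc.1.walkParity_eq_one hG.1 h
    rw [h.walkParity_eq_zero_of_tail hc.1.1 hno] at h1
    exact zero_ne_one h1
  obtain ⟨x, y, rfl⟩ := List.append_of_mem hd₀
  replace he : G.EdgeMem e (d₀ :: y ++ x) := by
    simp only [EmbeddedGraph.EdgeMem, List.mem_append] at he ⊢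
    tauto
  replace hc := hc.swap
  obtain ⟨u, hu⟩ := hc.1.1.2.1
  obtain rfl : G.dual.tail d₀ = u := hu.1
  -- an odd piece of the cycle
  obtain ⟨x', A, y', a, b, heq, hx', hA, hy', hodd⟩ := hu.exists_piece
    (Q := fun c => G.dual.walkParity ks π kt c = 1) hd₀S hd₀S (by simp [EmbeddedGraph.walkParity])
    (fun x y hxy => EmbeddedGraph.zmod_two_add_eq_one (by rwa [EmbeddedGraph.walkParity_append] at hxy))
    (hc.1.walkParity_eq_one hG.1 h)
  rw [heq] at hc he
  replace he : G.EdgeMem e (A ++ (y' ++ x')) := by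
    simp only [EmbeddedGraph.EdgeMem, List.mem_append] at he ⊢
    tauto
  replace hc := hc.swap
  rw [List.append_assoc] at hc
  have hR := hy'.append hx'
  have hear : G.dual.IsEar (G.face ks) π a A b := by
    rcases hA.isEar_or hπ.1.1 with hA | ⟨z, rfl, hz⟩
    · exact hA
    · rw [h.walkParity_eq_zero (by simpa using hz)] at hodd
      exact (zero_ne_one hodd).elim
  have main : ∀ e ∈ A ++ (y' ++ x'), ∃ c' : List D,
      G.IsShortestSeparatingCycle cap (G.tail ks) (G.tail kt) c' ∧ G.EdgeMem e c' ∧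
        G.dual.numCrossings ks π kt c' = 1 := by
    intro e he
    -- If the ear goes forwards along the path, the whole cycle is reversed; lengths, edges and
    -- parities do not change.
    rcases le_total (ρ b) (ρ a) with hab | hab
    · obtain ⟨c', h1, h2, h3⟩ := hG.exists_single_crossing_of_isEar hcap_rev hcap_pos h hρ hρp hc
        hear hodd hR hab he
      exact ⟨c', h1, Or.inl h2, h3⟩
    · have hc' := hc.reverse hcap_rev
      rw [List.map_append, List.reverse_append] at hc'
      have he' : G.rev e ∈ (A.map G.rev).reverse ++ ((y' ++ x').map G.rev).reverse := by
        rw [List.mem_append, EmbeddedGraph.mem_reverse_map_rev, EmbeddedGraph.mem_reverse_map_rev, G.rev_rev,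
          ← List.mem_append]
        exact he
      obtain ⟨c', h1, h2, h3⟩ := hG.exists_single_crossing_of_isEar hcap_rev hcap_pos h hρ hρp
        hc'.swap hear.reverse ((G.dual.walkParity_reverse ks π kt A).trans hodd) hR.reverse hab he'
      exact ⟨c', h1, Or.inr h2, h3⟩
  rcases he with he | he
  · exact main e he
  · obtain ⟨c', h1, h2, h3⟩ := main _ he
    exact ⟨c', h1, EmbeddedGraph.edgeMem_rev_iff.1 h2, h3⟩
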